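/- Let $\Gamma_1=\{(t,0):t\le 1\}$, $\Gamma_0=\{(t,0):t\le 0\}$, $S_1=\{(t,0):0\le t\le 1\}$ in $\mathbb{R}^2$ and $D_r=\{x\in\mathbb{R}^2:|x|<r\}$. For a real-valued function $w$ that is $H^1$ on bounded parts of the upper and of the lower half-plane, let $\gamma_+(w)$ and $\gamma_-(w)$ be its traces on the $x_1$-axis from above and from below. Let $\widetilde X$ be the space of all real-valued $w\in L^1_{\mathrm{loc}}(\mathbb{R}^2)$ such that $w\in H^1(D_r\setminus\Gamma_1)$ for all $r>0$, $\nabla w\in L^2(\mathbb{R}^2\setminus\Gamma_1,\mathbb{R}^2)$ and $\gamma_+(w)+\gamma_-(w)=0$ on $\Gamma_0$. For an odd $k\in\mathbb{N}$ and $\zeta\in\mathbb{R}$ let $$G_k(\zeta)=\min\left\{\frac12\int_{\mathbb{R}^2\setminus\Gamma_1}|\nabla v|^2\,dx+k\cos\zeta\int_{S_1}|x|^{\frac k2-1}\gamma_+(v)\,dS-\cos\zeta\sin\zeta\ :\ v\in\widetilde X,\ \gamma_+(v)+\gamma_-(v)=2|x|^{\frac k2}\sin\zeta\ \text{on } S_1\right\}.$$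 Then, for every odd $k\in\mathbb{N}$, this minimum is attained for every $\zeta\in\mathbb{R}$, and $G=G_k$ has the following properties: (i) $G$ is continuous on $\mathbb{R}$; (ii) $G(0)<0$ and $G(\frac\pi2)>0$; (iii) $G(\zeta+\pi)=G(\zeta)$ for every $\zeta\in\mathbb{R}$; (iv) $G(\pi-\zeta)=G(\zeta)$ for every $\zeta\in\mathbb{R}$; (v) $G$ is strictly increasing in $(\frac\pi4,\frac\pi2)$; (vi) $G$ is strictly increasing in every interval $I\subset(0,\frac\pi2)$ such that $G>0$ in $I$. -/

import Mathlib

open scoped ContDiff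

namespace SlitPlane

/-! The plane is `ℝ × ℝ` with Lebesgue measure. Euclidean lengths are always written out in
coordinates, so the sup norm that Mathlib puts on `ℝ × ℝ` plays no role. -/

/-- Test functions `C_c^∞(U)`: smooth functions on the plane with compact support inside `U`. -/
def IsTestOn (U : Set (ℝ × ℝ)) (φ : ℝ × ℝ → ℝ) : Prop :=
  ContDiff ℝ ∞ φ ∧ HasCompactSupport φ ∧ tsupport φ ⊆ U

/-- The Euclidean scalar product of the plane. -/
def dot (a b : ℝ × ℝ) : ℝ := a.1 * b.1 + a.2 * b.2

/-- `g` is the weak (distributional) gradient of `w` in the open set `U`: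
`∫_U w ∂_e φ = - ∫_U (g · e) φ` for every `φ ∈ C_c^∞(U)` and every direction `e`. -/
def HasWeakGrad (U : Set (ℝ × ℝ)) (w : ℝ × ℝ → ℝ) (g : ℝ × ℝ → ℝ × ℝ) : Prop :=
  MeasureTheory.LocallyIntegrableOn w U ∧ MeasureTheory.LocallyIntegrableOn g U ∧
    ∀ φ : ℝ × ℝ → ℝ, IsTestOn U φ → ∀ e : ℝ × ℝ,
      ∫ x in U, w x * fderiv ℝ φ x e = - ∫ x in U, dot (g x) e * φ x

/-- `w ∈ H¹(U)`: both `w` and its weak gradient are square integrable on `U`. -/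
def MemH1 (U : Set (ℝ × ℝ)) (w : ℝ × ℝ → ℝ) : Prop :=
  MeasureTheory.MemLp w 2 (MeasureTheory.volume.restrict U) ∧
    ∃ g : ℝ × ℝ → ℝ × ℝ, HasWeakGrad U w g ∧
      MeasureTheory.MemLp g 2 (MeasureTheory.volume.restrict U)

/-- The open half-plane above the `x₁`-axis. -/
def upper : Set (ℝ × ℝ) := {x | 0 < x.2}

/-- The open half-plane below the `x₁`-axis. -/
def lower : Set (ℝ × ℝ) := {x | x.2 < 0}

/-- Traces on the `x₁`-axis, which is identified with `ℝ` through `t ↦ (t, 0)`.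
For `H` one of the half-planes `upper`, `lower`, with outer unit normal `n`, the locally integrable
function `p` is the trace of `w` from the side of `H`: `w` has in `H` a weak gradient `g`, both are
integrable on bounded parts of `H`, and Green's formula
`∫_H w ∂_e φ = - ∫_H (g · e) φ + (n · e) ∫_ℝ p(t) φ(t, 0) dt`
holds for all directions `e` and all `φ ∈ C_c^∞(ℝ²)`; these `φ` need not vanish on the axis.
This determines `p` almost everywhere. -/
def IsTrace (H : Set (ℝ × ℝ)) (n : ℝ × ℝ) (w : ℝ × ℝ → ℝ) (p : ℝ → ℝ) : Prop :=
  MeasureTheory.LocallyIntegrable p MeasureTheory.volume ∧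
  MeasureTheory.LocallyIntegrable w (MeasureTheory.volume.restrict H) ∧
    ∃ g : ℝ × ℝ → ℝ × ℝ,
      MeasureTheory.LocallyIntegrable g (MeasureTheory.volume.restrict H) ∧
      ∀ φ : ℝ × ℝ → ℝ, IsTestOn Set.univ φ → ∀ e : ℝ × ℝ,
        ∫ x in H, w x * fderiv ℝ φ x e =
          - (∫ x in H, dot (g x) e * φ x) + dot n e * ∫ t : ℝ, p t * φ (t, 0)

/-- `p = γ₊(w)`, the trace on the `x₁`-axis from above. -/
def IsUpperTrace (w : ℝ × ℝ → ℝ) (p : ℝ → ℝ) : Prop := IsTrace upper (0, -1) w p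

/-- `q = γ₋(w)`, the trace on the `x₁`-axis from below. -/
def IsLowerTrace (w : ℝ × ℝ → ℝ) (q : ℝ → ℝ) : Prop := IsTrace lower (0, 1) w q

/-- The crack `Γ₁ = {(t, 0) : t ≤ 1}`. -/
def crack : Set (ℝ × ℝ) := {x | x.1 ≤ 1 ∧ x.2 = 0}

/-- The open Euclidean disk `D_r` centred at the origin. -/
def disk (r : ℝ) : Set (ℝ × ℝ) := {x | x.1 ^ 2 + x.2 ^ 2 < r ^ 2}

/-- The space `X̃`: locally integrable `w` which belong to `H¹(D_r ∖ Γ₁)` for all `r > 0`, with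
weak gradient in `L²(ℝ² ∖ Γ₁)`, and with `γ₊(w) + γ₋(w) = 0` on `Γ₀ = {(t, 0) : t ≤ 0}`. -/
def XTilde : Set (ℝ × ℝ → ℝ) :=
  {w | MeasureTheory.LocallyIntegrable w MeasureTheory.volume ∧
    (∀ r : ℝ, 0 < r → MemH1 (disk r \ crack) w) ∧
    (∃ g : ℝ × ℝ → ℝ × ℝ, HasWeakGrad crackᶜ w g ∧
      MeasureTheory.MemLp g 2 (MeasureTheory.volume.restrict crackᶜ)) ∧
    ∃ p q : ℝ → ℝ, IsUpperTrace w p ∧ IsLowerTrace w q ∧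
      ∀ᵐ t ∂(MeasureTheory.volume.restrict (Set.Iic (0 : ℝ))), p t + q t = 0}

/-- The set of the values
`½ ∫_{ℝ² ∖ Γ₁} |∇v|² + k cos ζ ∫_{S₁} |x|^{k/2 - 1} γ₊(v) dS - cos ζ sin ζ`
over all `v ∈ X̃` with `γ₊(v) + γ₋(v) = 2 |x|^{k/2} sin ζ` on `S₁ = {(t, 0) : 0 ≤ t ≤ 1}`. -/
def energyValues (k : ℕ) (ζ : ℝ) : Set ℝ :=
  {E | ∃ v ∈ XTilde, ∃ (g : ℝ × ℝ → ℝ × ℝ) (p q : ℝ → ℝ),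
    HasWeakGrad crackᶜ v g ∧ IsUpperTrace v p ∧ IsLowerTrace v q ∧
    (∀ᵐ t ∂(MeasureTheory.volume.restrict (Set.Icc (0 : ℝ) 1)),
      p t + q t = 2 * t ^ ((k : ℝ) / 2) * Real.sin ζ) ∧
    E = (1 / 2 : ℝ) * (∫ x in crackᶜ, dot (g x) (g x))
      + (k : ℝ) * Real.cos ζ * (∫ t in Set.Icc (0 : ℝ) 1, t ^ ((k : ℝ) / 2 - 1) * p t)
      - Real.cos ζ * Real.sin ζ}

/-- The function `G_k`, the minimum of the values above. -/
noncomputable def G (k : ℕ) (ζ : ℝ) : ℝ := sInf (energyValues k ζ)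

end SlitPlane

/-!
Write `k = 2m + 1` and let `L` be the odd polynomial with `L(X) + L(1/X) = 2((X + 1/X)/2)^k`. Then
`F(z) = L(√z - √(z - 1))` is holomorphic off the crack, and for `β = sin ζ - i cos ζ` the function
`u = Re(βF)` is admissible in the problem defining `G_k(ζ)`. Its gradient is the rotated gradient of
the conjugate function `Im(βF)`, whose tangential derivative along the crack produces exactly the
boundary term of the energy. Integrating by parts, every competitor `v` satisfies
`E(v) = E(u) + ½ ∫ |∇v - ∇u|²`, so `u` is the minimiser. Moreover `E(u) = -A cos 2ζ`, where `A > 0`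
is half the Dirichlet integral of `F`, and all the properties of `G_k(ζ) = -A cos 2ζ` can be read
off. Since `∇u` is singular at the ends `0` and `1` of `S₁`, the integration by parts needs the
integrability of traces of `H¹` functions against `|t - t₀|^(-1/2)`.
-/

namespace SlitPlane

open MeasureTheory Set Filter Topology

/-! ### Test functions and weak gradients -/

theorem integrable_mul_of_tsupport_subset {X : Type*} [TopologicalSpace X] [MeasurableSpace X]
    [OpensMeasurableSpace X] [T2Space X] {μ : Measure X} {U : Set X} {f φ : X → ℝ}
    (hf : LocallyIntegrableOn f U μ) (hφ : Continuous φ) (hc : HasCompactSupport φ)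
    (hU : tsupport φ ⊆ U) : Integrable (fun x => f x * φ x) μ := by
  have hK : IntegrableOn (fun x => f x * φ x) (tsupport φ) μ :=
    (hf.integrableOn_compact_subset hU hc).mul_continuousOn hφ.continuousOn hc
  refine (integrableOn_iff_integrable_of_support_subset fun x hx => ?_).1 hK
  exact subset_tsupport φ (right_ne_zero_of_mul hx)

theorem ae_eq_of_integral_mul_contDiff_eq {E : Type*} [NormedAddCommGroup E] [NormedSpace ℝ E]
    [FiniteDimensional ℝ E] [MeasurableSpace E] [BorelSpace E] {μ : Measure E} {U : Set E}
    (hU : IsOpen U) {f f' : E → ℝ} (hf : LocallyIntegrableOn f U μ)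
    (hf' : LocallyIntegrableOn f' U μ)
    (h : ∀ φ : E → ℝ, ContDiff ℝ ∞ φ → HasCompactSupport φ → tsupport φ ⊆ U →
      ∫ x, f x * φ x ∂μ = ∫ x, f' x * φ x ∂μ) :
    ∀ᵐ x ∂μ, x ∈ U → f x = f' x := by
  suffices ∀ᵐ x ∂μ, x ∈ U → (f - f') x = 0 by
    filter_upwards [this] with x hx hxU using sub_eq_zero.1 (hx hxU)
  refine hU.ae_eq_zero_of_integral_contDiff_smul_eq_zero (hf.sub hf') fun φ hφ hc hs => ?_
  calc ∫ x, φ x • (f - f') x ∂μ = ∫ x, (f x * φ x - f' x * φ x) ∂μ := by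
        congr with x; simp only [smul_eq_mul, Pi.sub_apply]; ring
    _ = 0 := by
        rw [integral_sub (integrable_mul_of_tsupport_subset hf hφ.continuous hc hs)
          (integrable_mul_of_tsupport_subset hf' hφ.continuous hc hs), h φ hφ hc hs, sub_self]

section TestFunctions

variable {U V : Set (ℝ × ℝ)} {φ f : ℝ × ℝ → ℝ} {μ : Measure (ℝ × ℝ)}

theorem IsTestOn.mono (h : IsTestOn U φ) (hUV : U ⊆ V) : IsTestOn V φ :=
  ⟨h.1, h.2.1, h.2.2.trans hUV⟩

theorem IsTestOn.continuous (h : IsTestOn U φ) : Continuous φ := h.1.continuous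

theorem IsTestOn.differentiable (h : IsTestOn U φ) : Differentiable ℝ φ :=
  h.1.differentiable (by simp)

theorem IsTestOn.fderiv (h : IsTestOn U φ) (e : ℝ × ℝ) :
    IsTestOn U (fun x => fderiv ℝ φ x e) :=
  ⟨(h.1.fderiv_right (m := ∞) (by simp)).clm_apply contDiff_const,
    h.2.1.fderiv_apply (𝕜 := ℝ) e, (tsupport_fderiv_apply_subset ℝ e).trans h.2.2⟩

theorem IsTestOn.apply_eq_zero (h : IsTestOn U φ) {x : ℝ × ℝ} (hx : x ∉ U) : φ x = 0 :=
  image_eq_zero_of_notMem_tsupport fun hx' => hx (h.2.2 hx')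

theorem IsTestOn.exists_norm_le (h : IsTestOn U φ) : ∃ C, ∀ x, ‖φ x‖ ≤ C :=
  h.2.1.exists_bound_of_continuous h.continuous

theorem IsTestOn.integrable_mul (h : IsTestOn U φ) (hf : LocallyIntegrableOn f U μ) :
    Integrable (fun x => f x * φ x) μ :=
  integrable_mul_of_tsupport_subset hf h.continuous h.2.1 h.2.2

theorem IsTestOn.integrable_mul' (h : IsTestOn U φ) (hf : LocallyIntegrable f μ) :
    Integrable (fun x => f x * φ x) μ :=
  h.integrable_mul (hf.locallyIntegrableOn U)

theorem IsTestOn.setIntegral_mul (h : IsTestOn U φ) (f : ℝ × ℝ → ℝ) :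
    ∫ x in U, f x * φ x = ∫ x, f x * φ x :=
  setIntegral_eq_integral_of_forall_compl_eq_zero fun x hx => by rw [h.apply_eq_zero hx, mul_zero]

theorem isTestOn_mul {a b : ℝ → ℝ} (ha : ContDiff ℝ ∞ a) (hac : HasCompactSupport a)
    (hb : ContDiff ℝ ∞ b) (hbc : HasCompactSupport b) :
    IsTestOn {x | x.1 ∈ tsupport a} fun x => a x.1 * b x.2 := by
  refine ⟨(ha.comp contDiff_fst).mul (hb.comp contDiff_snd),
    HasCompactSupport.intro (hac.isCompact.prod hbc.isCompact) fun x hx => ?_,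
    closure_minimal (fun x hx => subset_tsupport a (left_ne_zero_of_mul hx))
      ((isClosed_tsupport a).preimage continuous_fst)⟩
  rw [mem_prod, not_and_or] at hx
  rcases hx with h | h
  · rw [image_eq_zero_of_notMem_tsupport h, zero_mul]
  · rw [image_eq_zero_of_notMem_tsupport h, mul_zero]

theorem exists_isTestOn_eq_on_axis {a : ℝ → ℝ} (ha : ContDiff ℝ ∞ a) (hc : HasCompactSupport a) :
    ∃ φ, IsTestOn {x | x.1 ∈ tsupport a} φ ∧ ∀ t, φ (t, 0) = a t := by
  let b : ContDiffBump (0 : ℝ) := ⟨1, 2, by norm_num, by norm_num⟩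
  have hb : b 0 = 1 := b.one_of_mem_closedBall (by simp [b])
  exact ⟨_, isTestOn_mul ha hc b.contDiff b.hasCompactSupport, fun t => by simp only [hb, mul_one]⟩

end TestFunctions

theorem dot_comm (a b : ℝ × ℝ) : dot a b = dot b a := by
  simp only [dot, mul_comm]

theorem abs_dot_le (a b : ℝ × ℝ) : |dot a b| ≤ 2 * (‖a‖ * ‖b‖) :=
  calc |dot a b| ≤ |a.1 * b.1| + |a.2 * b.2| := abs_add_le _ _
    _ = ‖a.1‖ * ‖b.1‖ + ‖a.2‖ * ‖b.2‖ := by rw [abs_mul, abs_mul]; rfl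
    _ ≤ ‖a‖ * ‖b‖ + ‖a‖ * ‖b‖ := by
      gcongr <;> first | exact norm_fst_le _ | exact norm_snd_le _
    _ = 2 * (‖a‖ * ‖b‖) := by ring

/-- The scalar product with a fixed vector as a continuous linear map. -/
noncomputable def dotCLM (e : ℝ × ℝ) : ℝ × ℝ →L[ℝ] ℝ :=
  e.1 • ContinuousLinearMap.fst ℝ ℝ ℝ + e.2 • ContinuousLinearMap.snd ℝ ℝ ℝ

theorem dotCLM_apply (e a : ℝ × ℝ) : dotCLM e a = dot a e := by
  simp [dotCLM, dot, mul_comm]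

section WeakGrad

variable {U V : Set (ℝ × ℝ)} {w : ℝ × ℝ → ℝ} {g g' : ℝ × ℝ → ℝ × ℝ} {μ : Measure (ℝ × ℝ)}

theorem integrable_dot_const (h : Integrable g μ) (e : ℝ × ℝ) :
    Integrable (fun x => dot (g x) e) μ := by
  simpa only [dotCLM_apply] using (dotCLM e).integrable_comp h

theorem locallyIntegrableOn_dot_const (h : LocallyIntegrableOn g U μ) (e : ℝ × ℝ) :
    LocallyIntegrableOn (fun x => dot (g x) e) U μ := fun x hx =>
  let ⟨s, hs, hi⟩ := h x hx
  ⟨s, hs, integrable_dot_const hi e⟩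

theorem locallyIntegrable_dot_const (h : LocallyIntegrable g μ) (e : ℝ × ℝ) :
    LocallyIntegrable (fun x => dot (g x) e) μ :=
  locallyIntegrableOn_univ.1 (locallyIntegrableOn_dot_const (h.locallyIntegrableOn univ) e)

theorem HasWeakGrad.mono (h : HasWeakGrad U w g) (hVU : V ⊆ U) : HasWeakGrad V w g := by
  refine ⟨h.1.mono_set hVU, h.2.1.mono_set hVU, fun φ hφ e => ?_⟩
  have hU := h.2.2 φ (hφ.mono hVU) e
  rwa [((hφ.fderiv e).mono hVU).setIntegral_mul, (hφ.mono hVU).setIntegral_mul,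
    ← (hφ.fderiv e).setIntegral_mul, ← hφ.setIntegral_mul] at hU

theorem HasWeakGrad.ae_eq (hU : IsOpen U) (h : HasWeakGrad U w g) (h' : HasWeakGrad U w g') :
    g =ᵐ[volume.restrict U] g' := by
  have hdot : ∀ e, ∀ᵐ x, x ∈ U → dot (g x) e = dot (g' x) e := fun e =>
    ae_eq_of_integral_mul_contDiff_eq hU (locallyIntegrableOn_dot_const h.2.1 e)
      (locallyIntegrableOn_dot_const h'.2.1 e) fun φ h₁ h₂ h₃ => by
        have hφ : IsTestOn U φ := ⟨h₁, h₂, h₃⟩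
        rw [← hφ.setIntegral_mul, ← hφ.setIntegral_mul, ← neg_inj, ← h.2.2 φ hφ e, h'.2.2 φ hφ e]
  rw [EventuallyEq, ae_restrict_iff' hU.measurableSet]
  filter_upwards [hdot (1, 0), hdot (0, 1)] with x h₁ h₂ hx
  ext
  · simpa only [dot, mul_one, mul_zero, add_zero] using h₁ hx
  · simpa only [dot, mul_one, mul_zero, zero_add] using h₂ hx

end WeakGrad

/-! ### Green's formula and traces -/

/-- Green's formula for the triple formed by `w`, its gradient `g` and its boundary values `p` on
the axis: the unfolded form of `IsTrace`, in which the gradient is a parameter. -/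
structure GreenOn (H : Set (ℝ × ℝ)) (n : ℝ × ℝ) (w : ℝ × ℝ → ℝ) (g : ℝ × ℝ → ℝ × ℝ)
    (p : ℝ → ℝ) : Prop where
  locallyIntegrable_trace : LocallyIntegrable p volume
  locallyIntegrable : LocallyIntegrable w (volume.restrict H)
  locallyIntegrable_grad : LocallyIntegrable g (volume.restrict H)
  green : ∀ φ : ℝ × ℝ → ℝ, IsTestOn univ φ → ∀ e : ℝ × ℝ,
    ∫ x in H, w x * fderiv ℝ φ x e =
      - (∫ x in H, dot (g x) e * φ x) + dot n e * ∫ t : ℝ, p t * φ (t, 0)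

section Traces

variable {H U : Set (ℝ × ℝ)} {n : ℝ × ℝ} {w : ℝ × ℝ → ℝ} {g g' : ℝ × ℝ → ℝ × ℝ} {p p' q : ℝ → ℝ}

theorem isTrace_iff_exists_greenOn : IsTrace H n w p ↔ ∃ g, GreenOn H n w g p :=
  ⟨fun ⟨h₁, h₂, g, h₃, h₄⟩ => ⟨g, h₁, h₂, h₃, h₄⟩, fun ⟨g, h⟩ => ⟨h.1, h.2, g, h.3, h.4⟩⟩

theorem IsTrace.congr {w' : ℝ × ℝ → ℝ} (h : IsTrace H n w p) (hw : w =ᵐ[volume.restrict H] w') :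
    IsTrace H n w' p := by
  obtain ⟨hp, hwl, g, hg, hgreen⟩ := h
  refine ⟨hp, hwl.congr hw, g, hg, fun φ hφ e => ?_⟩
  rw [← hgreen φ hφ e]
  exact integral_congr_ae (hw.symm.mul .rfl)

theorem GreenOn.congr_grad (h : GreenOn H n w g p) (hg : g =ᵐ[volume.restrict H] g') :
    GreenOn H n w g' p where
  locallyIntegrable_trace := h.locallyIntegrable_trace
  locallyIntegrable := h.locallyIntegrable
  locallyIntegrable_grad := locallyIntegrableOn_univ.1 <|
    (h.locallyIntegrable_grad.locallyIntegrableOn univ).congr (ae_restrict_of_ae hg)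
  green φ hφ e := by
    rw [h.green φ hφ e]
    congr 2
    exact integral_congr_ae (hg.mono fun x hx => by simp only [hx])

theorem GreenOn.hasWeakGrad (hH : ∀ t : ℝ, (t, (0 : ℝ)) ∉ H) (h : GreenOn H n w g p) :
    HasWeakGrad H w g := by
  refine ⟨locallyIntegrableOn_of_locallyIntegrable_restrict h.locallyIntegrable,
    locallyIntegrableOn_of_locallyIntegrable_restrict h.locallyIntegrable_grad, fun φ hφ e => ?_⟩
  simp only [h.green φ (hφ.mono (subset_univ _)) e, hφ.apply_eq_zero (hH _), mul_zero,
    integral_zero, add_zero]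

theorem IsTrace.greenOn (hHo : IsOpen H) (hH : ∀ t : ℝ, (t, (0 : ℝ)) ∉ H) (hHU : H ⊆ U)
    (h : IsTrace H n w p) (hg : HasWeakGrad U w g) : GreenOn H n w g p := by
  obtain ⟨g', h'⟩ := isTrace_iff_exists_greenOn.1 h
  exact h'.congr_grad ((h'.hasWeakGrad hH).ae_eq hHo (hg.mono hHU))

theorem GreenOn.trace_ae_eq (hn : dot n n ≠ 0) (h : GreenOn H n w g p)
    (h' : GreenOn H n w g p') : p =ᵐ[volume] p' := by
  have := ae_eq_of_integral_mul_contDiff_eq isOpen_univ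
    (h.locallyIntegrable_trace.locallyIntegrableOn univ)
    (h'.locallyIntegrable_trace.locallyIntegrableOn univ) fun a ha hc _ => by
      obtain ⟨φ, hφ, hφa⟩ := exists_isTestOn_eq_on_axis ha hc
      have hgreen := h.green φ (hφ.mono (subset_univ _)) n
      rw [h'.green φ (hφ.mono (subset_univ _)) n, add_right_inj] at hgreen
      simpa only [hφa] using (mul_left_cancel₀ hn hgreen).symm
  exact this.mono fun t ht => ht (mem_univ t)

theorem isOpen_upper : IsOpen upper := isOpen_lt continuous_const continuous_snd

theorem isOpen_lower : IsOpen lower := isOpen_lt continuous_snd continuous_const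

theorem isClosed_crack : IsClosed crack :=
  (isClosed_le continuous_fst continuous_const).inter (isClosed_eq continuous_snd continuous_const)

theorem axis_notMem_upper (t : ℝ) : (t, (0 : ℝ)) ∉ upper := lt_irrefl (0 : ℝ)

theorem axis_notMem_lower (t : ℝ) : (t, (0 : ℝ)) ∉ lower := lt_irrefl (0 : ℝ)

theorem upper_subset_compl_crack : upper ⊆ crackᶜ := fun _ hx h => (ne_of_gt hx) h.2

theorem lower_subset_compl_crack : lower ⊆ crackᶜ := fun _ hx h => (ne_of_lt hx) h.2

theorem ae_snd_ne (a : ℝ) : ∀ᵐ x : ℝ × ℝ, x.2 ≠ a :=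
  Measure.quasiMeasurePreserving_snd.ae (Measure.ae_ne volume a)

theorem restrict_compl_crack : (volume : Measure (ℝ × ℝ)).restrict crackᶜ = volume :=
  Measure.restrict_eq_self_of_ae_mem <| (ae_snd_ne 0).mono fun _ hx h => hx h.2

theorem integral_eq_upper_add_lower {f : ℝ × ℝ → ℝ} (hf : Integrable f) :
    ∫ x, f x = (∫ x in upper, f x) + ∫ x in lower, f x := by
  have hd : Disjoint upper lower :=
    Set.disjoint_left.2 fun _ h h' => lt_asymm (mem_ofPred.1 h) (mem_ofPred.1 h')
  have hae : ∀ᵐ x : ℝ × ℝ, x ∈ upper ∪ lower := (ae_snd_ne 0).mono fun _ hx => hx.lt_or_gt.symm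
  rw [← setIntegral_union hd isOpen_lower.measurableSet hf.integrableOn hf.integrableOn,
    Measure.restrict_eq_self_of_ae_mem hae]

theorem traces_ae_eq_off_crack (hg : HasWeakGrad crackᶜ w g) (hp : GreenOn upper (0, -1) w g p)
    (hq : GreenOn lower (0, 1) w g q) : ∀ᵐ t : ℝ, 1 < t → p t = q t :=
  ae_eq_of_integral_mul_contDiff_eq isOpen_Ioi (hp.locallyIntegrable_trace.locallyIntegrableOn _)
    (hq.locallyIntegrable_trace.locallyIntegrableOn _) fun a ha hc hs => by
      obtain ⟨φ, hφ, hφa⟩ := exists_isTestOn_eq_on_axis ha hc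
      have hφc : IsTestOn crackᶜ φ := hφ.mono fun x hx hxc => not_le.2 (hs hx) hxc.1
      have hup := hp.green φ (hφ.mono (subset_univ _)) (0, 1)
      have hlow := hq.green φ (hφ.mono (subset_univ _)) (0, 1)
      have hplane := hg.2.2 φ hφc (0, 1)
      rw [restrict_compl_crack,
        integral_eq_upper_add_lower ((hφc.fderiv _).integrable_mul hg.1),
        integral_eq_upper_add_lower
          (hφc.integrable_mul (locallyIntegrableOn_dot_const hg.2.1 _))] at hplane
      simp only [hφa, dot, mul_zero, zero_add, mul_one] at hup hlow hplane
      linarith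

end Traces

/-! ### Linear changes of variables fixing the axis -/

section ChangeOfVariables

variable {L : (ℝ × ℝ) ≃L[ℝ] (ℝ × ℝ)} {A : (ℝ × ℝ) →L[ℝ] (ℝ × ℝ)} {H : Set (ℝ × ℝ)} {n : ℝ × ℝ}
  {w φ : ℝ × ℝ → ℝ} {g : ℝ × ℝ → ℝ × ℝ} {p : ℝ → ℝ}

theorem setIntegral_comp_equiv (hL : MeasurePreserving L) (H : Set (ℝ × ℝ)) (f : ℝ × ℝ → ℝ) :
    ∫ x in L ⁻¹' H, f (L x) = ∫ x in H, f x :=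
  hL.setIntegral_preimage_emb L.toHomeomorph.measurableEmbedding f H

theorem locallyIntegrable_comp_equiv {E : Type*} [NormedAddCommGroup E] {f : ℝ × ℝ → E}
    (hL : MeasurePreserving L) (hf : LocallyIntegrable f (volume.restrict H)) :
    LocallyIntegrable (fun x => f (L x)) (volume.restrict (L ⁻¹' H)) := fun x =>
  have hemb := L.toHomeomorph.measurableEmbedding
  let ⟨s, hs, hi⟩ := hf (L x)
  ⟨L ⁻¹' s, L.continuous.continuousAt.preimage_mem_nhds hs,
    ((hL.restrict_preimage_emb hemb H).integrableOn_comp_preimage hemb).2 hi⟩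

theorem IsTestOn.comp_equiv (h : IsTestOn univ φ) (L : (ℝ × ℝ) ≃L[ℝ] (ℝ × ℝ)) :
    IsTestOn univ (fun x => φ (L x)) :=
  ⟨h.1.comp L.contDiff, h.2.1.comp_homeomorph L.toHomeomorph, subset_univ _⟩

theorem GreenOn.comp_equiv (h : GreenOn H n w g p) (hL : MeasurePreserving L)
    (haxis : ∀ t, L (t, 0) = (t, 0)) (hA : ∀ a b, dot (A a) b = dot a (L b)) :
    GreenOn (L ⁻¹' H) (A n) (fun x => w (L x)) (fun x => A (g (L x))) p where
  locallyIntegrable_trace := h.locallyIntegrable_trace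
  locallyIntegrable := locallyIntegrable_comp_equiv hL h.locallyIntegrable
  locallyIntegrable_grad := fun x =>
    let ⟨s, hs, hi⟩ := locallyIntegrable_comp_equiv hL h.locallyIntegrable_grad x
    ⟨s, hs, A.integrable_comp hi⟩
  green φ hφ e := by
    have hgreen := h.green _ (hφ.comp_equiv L.symm) (L e)
    have hfderiv : ∀ x, fderiv ℝ (fun x => φ (L.symm x)) (L x) (L e) = fderiv ℝ φ x e := fun x =>
      (DFunLike.congr_fun (L.symm.comp_right_fderiv (f := φ)) (L e)).trans (by simp)
    have hsymm : ∀ t, L.symm (t, 0) = (t, 0) := fun t => by rw [L.symm_apply_eq, haxis]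
    rw [← setIntegral_comp_equiv hL, ← setIntegral_comp_equiv hL H] at hgreen
    simpa only [hfderiv, hsymm, hA, L.symm_apply_apply] using hgreen

end ChangeOfVariables

/-- The reflection of the plane in the `x₁`-axis, exchanging the two sides of the crack. -/
noncomputable def reflect : (ℝ × ℝ) ≃L[ℝ] (ℝ × ℝ) :=
  (ContinuousLinearEquiv.refl ℝ ℝ).prodCongr (ContinuousLinearEquiv.neg ℝ)

theorem reflect_apply (x : ℝ × ℝ) : reflect x = (x.1, -x.2) := by simp [reflect]

theorem reflect_reflect (x : ℝ × ℝ) : reflect (reflect x) = x := by simp [reflect_apply]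

theorem dot_reflect_left (a b : ℝ × ℝ) : dot (reflect a) b = dot a (reflect b) := by
  simp [dot, reflect_apply]

theorem norm_reflect (x : ℝ × ℝ) : ‖reflect x‖ = ‖x‖ := by
  simp [reflect_apply, Prod.norm_def]

theorem measurePreserving_reflect : MeasurePreserving reflect := by
  have h : ⇑reflect = Prod.map id Neg.neg := funext reflect_apply
  rw [h]
  exact (MeasurePreserving.id volume).prod (Measure.measurePreserving_neg volume)

theorem reflect_preimage_lower : reflect ⁻¹' lower = upper := by
  ext; simp [reflect_apply, lower, upper]

theorem reflect_preimage_upper : reflect ⁻¹' upper = lower := by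
  ext; simp [reflect_apply, lower, upper]

section Reflection

variable {w : ℝ × ℝ → ℝ} {g : ℝ × ℝ → ℝ × ℝ} {p : ℝ → ℝ}

theorem GreenOn.comp_reflect {H : Set (ℝ × ℝ)} {n : ℝ × ℝ} (h : GreenOn H n w g p) :
    GreenOn (reflect ⁻¹' H) (reflect n) (fun x => w (reflect x))
      (fun x => reflect (g (reflect x))) p :=
  h.comp_equiv (A := reflect.toContinuousLinearMap) measurePreserving_reflect
    (fun t => by simp [reflect_apply]) dot_reflect_left

theorem GreenOn.comp_reflect_of_lower (h : GreenOn lower (0, 1) w g p) :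
    GreenOn upper (0, -1) (fun x => w (reflect x)) (fun x => reflect (g (reflect x))) p := by
  simpa only [reflect_preimage_lower, reflect_apply (0, 1)] using h.comp_reflect

theorem GreenOn.comp_reflect_of_upper (h : GreenOn upper (0, -1) w g p) :
    GreenOn lower (0, 1) (fun x => w (reflect x)) (fun x => reflect (g (reflect x))) p := by
  simpa only [reflect_preimage_upper, reflect_apply (0, -1), neg_neg] using h.comp_reflect

theorem memLp_comp_reflect (hg : MemLp g 2) : MemLp (fun x => reflect (g (reflect x))) 2 :=
  (hg.comp_measurePreserving measurePreserving_reflect).of_le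
    (reflect.continuous.comp_aestronglyMeasurable
      (hg.comp_measurePreserving measurePreserving_reflect).1)
    (Eventually.of_forall fun _ => (norm_reflect _).le)

end Reflection

/-- The transpose `(a, b) ↦ (a, b + σ a)` of `shear σ`. -/
noncomputable def shearTranspose (σ : ℝ) : (ℝ × ℝ) ≃L[ℝ] (ℝ × ℝ) :=
  (ContinuousLinearEquiv.refl ℝ ℝ).skewProd (ContinuousLinearEquiv.refl ℝ ℝ)
    (σ • ContinuousLinearMap.id ℝ ℝ)

/-- The shear `(t, y) ↦ (t + σ y, y)`, turning vertical lines into lines of direction `(σ, 1)`. -/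
noncomputable def shear (σ : ℝ) : (ℝ × ℝ) ≃L[ℝ] (ℝ × ℝ) :=
  ((ContinuousLinearEquiv.prodComm ℝ ℝ ℝ).trans (shearTranspose σ)).trans
    (ContinuousLinearEquiv.prodComm ℝ ℝ ℝ)

theorem shearTranspose_apply (σ : ℝ) (x : ℝ × ℝ) : shearTranspose σ x = (x.1, x.2 + σ * x.1) := by
  simp [shearTranspose]

theorem shear_apply (σ : ℝ) (x : ℝ × ℝ) : shear σ x = (x.1 + σ * x.2, x.2) := by
  simp [shear, shearTranspose]

theorem shear_preimage_upper (σ : ℝ) : shear σ ⁻¹' upper = upper := by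
  ext; simp [shear_apply, upper]

theorem measurePreserving_shear (σ : ℝ) : MeasurePreserving (shear σ) := by
  have hskew : MeasurePreserving (fun x : ℝ × ℝ => (x.1, x.2 + σ * x.1))
      ((volume : Measure ℝ).prod (volume : Measure ℝ)) (volume.prod volume) :=
    (MeasurePreserving.id volume).skew_product (g := fun y t => t + σ * y) (by fun_prop)
      (Eventually.of_forall fun y => (measurePreserving_add_right volume (σ * y)).map_eq)
  rw [funext (shear_apply σ)]
  exact (Measure.measurePreserving_swap.comp hskew).comp Measure.measurePreserving_swap

theorem GreenOn.comp_shear {w : ℝ × ℝ → ℝ} {g : ℝ × ℝ → ℝ × ℝ} {p : ℝ → ℝ}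
    (h : GreenOn upper (0, -1) w g p) (σ : ℝ) :
    GreenOn upper (0, -1) (fun x => w (shear σ x))
      (fun x => shearTranspose σ (g (shear σ x))) p := by
  have hsheared := h.comp_equiv (A := (shearTranspose σ).toContinuousLinearMap)
    (measurePreserving_shear σ) (fun t => by simp [shear_apply])
    fun a b => by simp [shearTranspose_apply, shear_apply, dot]; ring
  simpa [shear_preimage_upper, shearTranspose_apply] using hsheared

/-! ### Rotated gradients -/

/-- The gradient of `ψ` rotated by a right angle, `(∂₂ψ, -∂₁ψ)`. -/
noncomputable def rotGrad (ψ : ℝ × ℝ → ℝ) (x : ℝ × ℝ) : ℝ × ℝ :=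
  (fderiv ℝ ψ x (0, 1), -fderiv ℝ ψ x (1, 0))

theorem fderiv_fderiv_apply_comm {E : Type*} [NormedAddCommGroup E] [NormedSpace ℝ E] {ψ : E → ℝ}
    (hψ : ContDiff ℝ 2 ψ) (x a b : E) :
    fderiv ℝ (fun y => fderiv ℝ ψ y a) x b = fderiv ℝ (fun y => fderiv ℝ ψ y b) x a := by
  have hd : DifferentiableAt ℝ (fderiv ℝ ψ) x :=
    (hψ.fderiv_right (m := 1) le_rfl).differentiable (by simp) x
  rw [fderiv_clm_apply hd (differentiableAt_const _),
    fderiv_clm_apply hd (differentiableAt_const _)]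
  simpa using hψ.contDiffAt.isSymmSndFDerivAt (by simp) b a

/-- Green's formula for `∂₂ψ` in direction `e₁` and for `∂₁ψ` in direction `e₂`: the terms with `w`
cancel, so only the gradient and the trace of `w` are left. -/
theorem GreenOn.integral_dot_rotGrad {w ψ : ℝ × ℝ → ℝ} {g : ℝ × ℝ → ℝ × ℝ} {p : ℝ → ℝ}
    (h : GreenOn upper (0, -1) w g p) (hψ : IsTestOn univ ψ) :
    ∫ x in upper, dot (g x) (rotGrad ψ x) = -∫ t : ℝ, p t * (rotGrad ψ (t, 0)).2 := by
  have hgreen₁ := h.green _ (hψ.fderiv (0, 1)) (1, 0)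
  have hgreen₂ := h.green _ (hψ.fderiv (1, 0)) (0, 1)
  simp only [fderiv_fderiv_apply_comm (contDiff_infty.1 hψ.1 2) _ (0, 1) (1, 0), hgreen₂]
    at hgreen₁
  have hint₁ := (hψ.fderiv (0, 1)).integrable_mul'
    (locallyIntegrable_dot_const h.locallyIntegrable_grad (1, 0))
  have hint₂ := (hψ.fderiv (1, 0)).integrable_mul'
    (locallyIntegrable_dot_const h.locallyIntegrable_grad (0, 1))
  simp only [dot, mul_zero, zero_mul, add_zero, mul_one, zero_add, neg_mul, one_mul]
    at hgreen₁ hint₁ hint₂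
  calc ∫ x in upper, dot (g x) (rotGrad ψ x)
      = (∫ x in upper, (g x).1 * fderiv ℝ ψ x (0, 1))
        - ∫ x in upper, (g x).2 * fderiv ℝ ψ x (1, 0) := by
        simp only [← integral_sub hint₁ hint₂, dot, rotGrad, mul_neg, sub_eq_add_neg]
    _ = ∫ t : ℝ, p t * fderiv ℝ ψ (t, 0) (1, 0) := by linarith
    _ = _ := by simp only [rotGrad, mul_neg, integral_neg, neg_neg]

/-! ### Weighted integrability of traces -/

/-- The weight `|s|^{-1/2}` near a singular point of the crack, truncated to `[-1, 1]`. -/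
noncomputable def weight (s : ℝ) : ENNReal :=
  (Icc (-1 : ℝ) 1).indicator (fun s => ENNReal.ofReal (|s| ^ (-(1 / 2) : ℝ))) s

theorem measurable_weight : Measurable weight :=
  Measurable.indicator (by fun_prop) measurableSet_Icc

theorem locallyIntegrable_abs_rpow : LocallyIntegrable fun s : ℝ => |s| ^ (-(1 / 2) : ℝ) :=
  locallyIntegrable_of_norm_le_rpow (C := 1) (α := 1 / 2) (by simp) (by norm_num)
    (Eventually.of_forall fun s => by
      rw [one_mul, Real.norm_of_nonneg (by positivity), Real.norm_eq_abs])
    (by fun_prop : Measurable _).aestronglyMeasurable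

theorem lintegral_weight_lt_top : ∫⁻ s, weight s < ⊤ := by
  simp only [weight]
  rw [lintegral_indicator measurableSet_Icc]
  exact (locallyIntegrable_abs_rpow.integrableOn_isCompact isCompact_Icc).lintegral_lt_top

/-- The average of the weight over a fan of lines through `x`, as a function of the point where
they meet the axis. Unlike the weight itself this is square integrable. -/
noncomputable def fanWeight (t₀ : ℝ) (x : ℝ × ℝ) : ENNReal :=
  ∫⁻ σ in Ioo (0 : ℝ) 1, weight (x.1 - σ * x.2 - t₀)

theorem measurable_fanWeight (t₀ : ℝ) : Measurable (fanWeight t₀) :=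
  Measurable.lintegral_prod_right' (f := fun z : (ℝ × ℝ) × ℝ => weight (z.1.1 - z.2 * z.1.2 - t₀))
    (measurable_weight.comp (by fun_prop))

theorem weight_mul_le {y s : ℝ} (hy : 0 < y) :
    weight (y * s) ≤ ENNReal.ofReal (y ^ (-(1 / 2) : ℝ)) * (1 + weight s) := by
  unfold weight
  by_cases h : y * s ∈ Icc (-1 : ℝ) 1
  · rw [indicator_of_mem h, abs_mul, abs_of_pos hy, Real.mul_rpow hy.le (abs_nonneg _),
      ENNReal.ofReal_mul (by positivity)]
    gcongr
    by_cases hs : s ∈ Icc (-1 : ℝ) 1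
    · rw [indicator_of_mem hs]
      exact le_add_self
    · refine le_add_right (ENNReal.ofReal_le_one.2 ?_)
      exact Real.rpow_le_one_of_one_le_of_nonpos (not_lt.1 fun hlt => hs (abs_le.1 hlt.le))
        (by norm_num)
  · rw [indicator_of_notMem h]
    exact zero_le

theorem fanWeight_le {t₀ : ℝ} {x : ℝ × ℝ} (hx : 0 < x.2) :
    fanWeight t₀ x ≤ ENNReal.ofReal (x.2 ^ (-(1 / 2) : ℝ)) * (1 + ∫⁻ s, weight s) := by
  have hscale (σ : ℝ) : weight (x.1 - σ * x.2 - t₀)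
      ≤ ENNReal.ofReal (x.2 ^ (-(1 / 2) : ℝ)) * (1 + weight ((x.1 - t₀) / x.2 - σ)) := by
    have h := weight_mul_le (s := (x.1 - t₀) / x.2 - σ) hx
    rwa [show x.2 * ((x.1 - t₀) / x.2 - σ) = x.1 - σ * x.2 - t₀ by field_simp; ring] at h
  have hm : Measurable fun σ => weight ((x.1 - t₀) / x.2 - σ) :=
    measurable_weight.comp (by fun_prop)
  refine (lintegral_mono hscale).trans ?_
  rw [lintegral_const_mul _ (by fun_prop), lintegral_add_left measurable_const]
  refine mul_le_mul_right (add_le_add ?_ ?_) _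
  · simp
  · exact (setLIntegral_le_lintegral _ _).trans_eq (lintegral_sub_left_eq_self weight _)

theorem lintegral_fanWeight (t₀ y : ℝ) : ∫⁻ t, fanWeight t₀ (t, y) = ∫⁻ s, weight s := by
  have htranslate (σ : ℝ) : ∫⁻ t, weight (t - σ * y - t₀) = ∫⁻ s, weight s := by
    simp only [sub_sub]
    exact lintegral_sub_right_eq_self weight _
  have hm : Measurable fun z : ℝ × ℝ => weight (z.1 - z.2 * y - t₀) :=
    measurable_weight.comp (by fun_prop)
  unfold fanWeight
  rw [lintegral_lintegral_swap hm.aemeasurable]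
  simp [htranslate]

theorem lintegral_fanWeight_sq_lt_top (t₀ : ℝ) {b : ℝ} (hb : 0 ≤ b) :
    ∫⁻ x in univ ×ˢ Ioc 0 b, fanWeight t₀ x * fanWeight t₀ x < ⊤ := by
  set c := ∫⁻ s, weight s
  have hc : c < ⊤ := lintegral_weight_lt_top
  have hm := measurable_fanWeight t₀
  have hline : ∀ y ∈ Ioc 0 b, ∫⁻ t, fanWeight t₀ (t, y) * fanWeight t₀ (t, y)
      ≤ ENNReal.ofReal (y ^ (-(1 / 2) : ℝ)) * ((1 + c) * c) := fun y hy => by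
    refine (lintegral_mono fun t => mul_le_mul_left (fanWeight_le (x := (t, y)) hy.1) _).trans_eq ?_
    have hmy : Measurable fun t => fanWeight t₀ (t, y) := hm.comp (by fun_prop)
    dsimp only
    simp_rw [mul_assoc]
    rw [lintegral_const_mul' _ _ ENNReal.ofReal_ne_top, lintegral_const_mul _ hmy,
      lintegral_fanWeight]
  have hrpow : ∫⁻ y in Ioc 0 b, ENNReal.ofReal (y ^ (-(1 / 2) : ℝ)) < ⊤ :=
    ((intervalIntegrable_iff_integrableOn_Ioc_of_le hb).1
      (intervalIntegral.intervalIntegrable_rpow' (by norm_num))).lintegral_lt_top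
  rw [Measure.volume_eq_prod, ← Measure.prod_restrict, Measure.restrict_univ,
    lintegral_prod_symm' _ (hm.fun_mul hm)]
  refine (setLIntegral_mono' measurableSet_Ioc hline).trans_lt ?_
  rw [lintegral_mul_const _ (by fun_prop)]
  exact ENNReal.mul_lt_top hrpow
    (ENNReal.mul_lt_top (ENNReal.add_lt_top.2 ⟨ENNReal.one_lt_top, hc⟩) hc)

/-- A fixed cutoff in one variable: `1` on `[-1, 1]` and `0` off `(-2, 2)`. -/
noncomputable def cutoff : ContDiffBump (0 : ℝ) := ⟨1, 2, one_pos, one_lt_two⟩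

theorem cutoff_eq_one {y : ℝ} (hy : |y| ≤ 1) : cutoff y = 1 :=
  cutoff.one_of_mem_closedBall (by simpa [cutoff] using hy)

theorem cutoff_eq_zero {y : ℝ} (hy : 2 ≤ |y|) : cutoff y = 0 :=
  cutoff.zero_of_le_dist (by simpa [cutoff] using hy)

theorem enorm_cutoff_le_one (y : ℝ) : ‖cutoff y‖ₑ ≤ 1 := by
  rw [← ofReal_norm, ENNReal.ofReal_le_one, Real.norm_of_nonneg cutoff.nonneg]
  exact cutoff.le_one

theorem deriv_cutoff_eq_zero_of_lt {y : ℝ} (hy : |y| < 1) : deriv cutoff y = 0 := by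
  have : cutoff =ᶠ[𝓝 y] fun _ => (1 : ℝ) := by
    filter_upwards [(isOpen_lt continuous_abs continuous_const).mem_nhds hy] with z hz
    exact cutoff_eq_one hz.le
  rw [this.deriv_eq, deriv_const]

theorem deriv_cutoff_eq_zero_of_gt {y : ℝ} (hy : 2 < |y|) : deriv cutoff y = 0 := by
  have : cutoff =ᶠ[𝓝 y] fun _ => (0 : ℝ) := by
    filter_upwards [(isOpen_lt continuous_const continuous_abs).mem_nhds hy] with z hz
    exact cutoff_eq_zero hz.le
  rw [this.deriv_eq, deriv_const]

theorem contDiff_deriv_cutoff : ContDiff ℝ ∞ (deriv cutoff) :=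
  (contDiff_infty_iff_deriv.1 cutoff.contDiff).2

theorem exists_norm_deriv_cutoff_le : ∃ C, ∀ y, ‖deriv cutoff y‖ ≤ C :=
  cutoff.hasCompactSupport.deriv.exists_bound_of_continuous contDiff_deriv_cutoff.continuous

/-- The function whose integrals along vertical lines are the boundary values `-p` of `w`. -/
noncomputable def traceKernel (w : ℝ × ℝ → ℝ) (g : ℝ × ℝ → ℝ × ℝ) (x : ℝ × ℝ) : ℝ :=
  w x * deriv cutoff x.2 + (g x).2 * cutoff x.2

/-- A bound for `traceKernel` after shearing the vertical lines to slopes in `(0, 1)`. -/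
noncomputable def traceMajorant (w : ℝ × ℝ → ℝ) (g : ℝ × ℝ → ℝ × ℝ) (x : ℝ × ℝ) : ENNReal :=
  ‖w x‖ₑ * ‖deriv cutoff x.2‖ₑ + 2 * ‖g x‖ₑ * ‖cutoff x.2‖ₑ

theorem restrict_upper : (volume : Measure (ℝ × ℝ)).restrict upper
    = (volume : Measure ℝ).prod ((volume : Measure ℝ).restrict (Ioi 0)) := by
  have : upper = univ ×ˢ Ioi (0 : ℝ) := by ext; simp [upper]
  rw [this, Measure.volume_eq_prod, ← Measure.prod_restrict, Measure.restrict_univ]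

section WeightedTraces

variable {w : ℝ × ℝ → ℝ} {g : ℝ × ℝ → ℝ × ℝ} {p : ℝ → ℝ}

theorem GreenOn.aestronglyMeasurable_traceKernel (h : GreenOn upper (0, -1) w g p) :
    AEStronglyMeasurable (traceKernel w g) (volume.restrict upper) :=
  (h.locallyIntegrable.aestronglyMeasurable.mul
    (contDiff_deriv_cutoff.continuous.comp continuous_snd).aestronglyMeasurable).add
    ((continuous_snd.comp_aestronglyMeasurable h.locallyIntegrable_grad.aestronglyMeasurable).mul
      (cutoff.continuous.comp continuous_snd).aestronglyMeasurable)

theorem GreenOn.aemeasurable_traceMajorant (h : GreenOn upper (0, -1) w g p) :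
    AEMeasurable (traceMajorant w g) (volume.restrict upper) :=
  (h.locallyIntegrable.aestronglyMeasurable.enorm.mul
    (contDiff_deriv_cutoff.continuous.comp continuous_snd).enorm.measurable.aemeasurable).add
    ((h.locallyIntegrable_grad.aestronglyMeasurable.enorm.const_mul 2).mul
      (cutoff.continuous.comp continuous_snd).enorm.measurable.aemeasurable)

theorem GreenOn.integral_traceKernel_mul (h : GreenOn upper (0, -1) w g p) {η : ℝ → ℝ}
    (hη : ContDiff ℝ ∞ η) (hc : HasCompactSupport η) :
    Integrable (fun x => traceKernel w g x * η x.1) (volume.restrict upper) ∧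
      ∫ x in upper, traceKernel w g x * η x.1 = -∫ t, p t * η t := by
  have htest := (isTestOn_mul hη hc cutoff.contDiff cutoff.hasCompactSupport).mono
    (subset_univ _)
  have htest' := (isTestOn_mul hη hc contDiff_deriv_cutoff cutoff.hasCompactSupport.deriv).mono
    (subset_univ _)
  have hfderiv (x : ℝ × ℝ) : fderiv ℝ (fun x : ℝ × ℝ => η x.1 * cutoff x.2) x (0, 1)
      = η x.1 * deriv cutoff x.2 := by
    have h₁ := ((hη.differentiable (by simp)) x.1).hasDerivAt.comp_hasFDerivAt x
      (hasFDerivAt_fst (𝕜 := ℝ) (p := x))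
    have h₂ := ((cutoff.contDiff.differentiable (n := ∞) (by simp)) x.2).hasDerivAt.comp_hasFDerivAt
      x (hasFDerivAt_snd (𝕜 := ℝ) (p := x))
    exact (DFunLike.congr_fun (h₁.mul h₂).fderiv (0, 1)).trans (by simp)
  have hgreen := h.green _ htest (0, 1)
  have hint₁ := htest'.integrable_mul' h.locallyIntegrable
  have hint₂ := htest.integrable_mul' (locallyIntegrable_dot_const h.locallyIntegrable_grad (0, 1))
  have hsplit : (fun x => traceKernel w g x * η x.1) = fun x =>
      w x * (η x.1 * deriv cutoff x.2) + dot (g x) (0, 1) * (η x.1 * cutoff x.2) := by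
    ext x; simp only [traceKernel, dot]; ring
  simp only [hfderiv] at hgreen
  rw [hsplit]
  refine ⟨hint₁.add hint₂, ?_⟩
  rw [integral_add hint₁ hint₂, hgreen]
  simp [dot, cutoff_eq_one]

theorem GreenOn.trace_ae_eq_neg_integral (h : GreenOn upper (0, -1) w g p) :
    ∀ᵐ t, p t = -∫ y in Ioi (0 : ℝ), traceKernel w g (t, y) := by
  set P : ℝ → ℝ := fun t => ∫ y in Ioi (0 : ℝ), traceKernel w g (t, y)
  have htest (η : ℝ → ℝ) (hη : ContDiff ℝ ∞ η) (hc : HasCompactSupport η) :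
      Integrable (fun t => P t * η t) ∧ ∫ t, P t * η t = -∫ t, p t * η t := by
    obtain ⟨hint, heq⟩ := h.integral_traceKernel_mul hη hc
    rw [restrict_upper] at hint heq
    have hP (t : ℝ) : ∫ y in Ioi (0 : ℝ), traceKernel w g (t, y) * η t = P t * η t :=
      integral_mul_const _ _
    refine ⟨by simpa only [hP] using hint.integral_prod_left, ?_⟩
    rw [← heq, integral_prod _ hint]
    simp only [hP]
  have hlocal : LocallyIntegrable P := fun t => by
    let b : ContDiffBump t := ⟨1, 2, one_pos, one_lt_two⟩
    refine ⟨Metric.ball t 1, Metric.ball_mem_nhds t one_pos,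
      (htest b b.contDiff b.hasCompactSupport).1.integrableOn.congr_fun (fun s hs => ?_)
        Metric.isOpen_ball.measurableSet⟩
    simp only [b.one_of_mem_closedBall (Metric.ball_subset_closedBall hs), mul_one]
  have hae := ae_eq_of_integral_mul_contDiff_eq isOpen_univ
    (h.locallyIntegrable_trace.locallyIntegrableOn univ) (hlocal.neg.locallyIntegrableOn univ)
    fun η hη hc _ => by
      simp only [Pi.neg_apply, neg_mul, integral_neg, (htest η hη hc).2, neg_neg]
  exact hae.mono fun t ht => ht (mem_univ t)

theorem GreenOn.lintegral_trace_le_traceKernel (h : GreenOn upper (0, -1) w g p) {f : ℝ → ENNReal}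
    (hf : Measurable f) :
    ∫⁻ t, ‖p t‖ₑ * f t ≤ ∫⁻ x in upper, ‖traceKernel w g x‖ₑ * f x.1 := by
  have hm := h.aestronglyMeasurable_traceKernel
  rw [restrict_upper] at hm ⊢
  have hfm : AEMeasurable (fun x : ℝ × ℝ => f x.1)
      ((volume : Measure ℝ).prod ((volume : Measure ℝ).restrict (Ioi 0))) :=
    (hf.comp measurable_fst).aemeasurable
  rw [lintegral_prod _ (hm.enorm.fun_mul hfm)]
  refine lintegral_mono_ae ?_
  filter_upwards [h.trace_ae_eq_neg_integral, hm.prodMk_left] with t ht hmt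
  rw [lintegral_mul_const'' _ hmt.enorm, ht, enorm_neg]
  gcongr
  exact enorm_integral_le_lintegral_enorm _

theorem enorm_traceKernel_comp_shear_le {σ : ℝ} (hσ : σ ∈ Ioo (0 : ℝ) 1) (x : ℝ × ℝ) :
    ‖traceKernel (fun x => w (shear σ x)) (fun x => shearTranspose σ (g (shear σ x))) x‖ₑ
      ≤ traceMajorant w g (shear σ x) := by
  have hy : (shear σ x).2 = x.2 := by rw [shear_apply]
  have hg (a : ℝ × ℝ) : ‖(shearTranspose σ a).2‖ₑ ≤ 2 * ‖a‖ₑ := by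
    rw [← ofReal_norm, ← ofReal_norm, ← ENNReal.ofReal_ofNat, ← ENNReal.ofReal_mul (by norm_num),
      shearTranspose_apply]
    refine ENNReal.ofReal_le_ofReal ((norm_add_le _ _).trans ?_)
    have h₁ : ‖σ * a.1‖ ≤ 1 * ‖a‖ := by
      rw [norm_mul, Real.norm_of_nonneg hσ.1.le]
      gcongr
      exacts [hσ.2.le, norm_fst_le a]
    linarith [norm_snd_le a]
  rw [traceKernel, traceMajorant, hy]
  refine (enorm_add_le _ _).trans ?_
  rw [enorm_mul, enorm_mul]
  gcongr
  exact hg _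

theorem GreenOn.lintegral_trace_le_traceMajorant (h : GreenOn upper (0, -1) w g p) {σ : ℝ}
    (hσ : σ ∈ Ioo (0 : ℝ) 1) {f : ℝ → ENNReal} (hf : Measurable f) :
    ∫⁻ t, ‖p t‖ₑ * f t ≤ ∫⁻ x in upper, traceMajorant w g x * f (x.1 - σ * x.2) := by
  have hshear : MeasurePreserving (shear σ) (volume.restrict upper) (volume.restrict upper) := by
    simpa only [shear_preimage_upper] using
      (measurePreserving_shear σ).restrict_preimage isOpen_upper.measurableSet
  refine ((h.comp_shear σ).lintegral_trace_le_traceKernel hf).trans ?_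
  rw [← hshear.lintegral_comp_emb (shear σ).toHomeomorph.measurableEmbedding
    fun x => traceMajorant w g x * f (x.1 - σ * x.2)]
  refine lintegral_mono fun x => ?_
  gcongr
  · exact enorm_traceKernel_comp_shear_le hσ x
  · simp [shear_apply]

/-- Averaging over the slopes replaces the weight by the fan weight. -/
theorem GreenOn.lintegral_trace_mul_weight_le (h : GreenOn upper (0, -1) w g p) (t₀ : ℝ) :
    ∫⁻ t, ‖p t‖ₑ * weight (t - t₀) ≤ ∫⁻ x in upper, traceMajorant w g x * fanWeight t₀ x := by
  have hweight : Measurable fun z : ℝ × ℝ × ℝ => weight (z.2.1 - z.1 * z.2.2 - t₀) :=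
    measurable_weight.comp (by fun_prop)
  calc ∫⁻ t, ‖p t‖ₑ * weight (t - t₀)
      = ∫⁻ _ in Ioo (0 : ℝ) 1, ∫⁻ t, ‖p t‖ₑ * weight (t - t₀) := by simp
    _ ≤ ∫⁻ σ in Ioo (0 : ℝ) 1, ∫⁻ x in upper,
          traceMajorant w g x * weight (x.1 - σ * x.2 - t₀) :=
        setLIntegral_mono' measurableSet_Ioo fun σ hσ =>
          h.lintegral_trace_le_traceMajorant hσ (measurable_weight.comp (by fun_prop))
    _ = ∫⁻ x in upper, traceMajorant w g x * fanWeight t₀ x := by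
        rw [lintegral_lintegral_swap (h.aemeasurable_traceMajorant.comp_snd.mul
          hweight.aemeasurable)]
        exact lintegral_congr fun x =>
          lintegral_const_mul _ (measurable_weight.comp (by fun_prop))

theorem abs_sub_le_of_fanWeight_ne_zero {t₀ : ℝ} {x : ℝ × ℝ} (hx : 0 < x.2)
    (h : fanWeight t₀ x ≠ 0) : |x.1 - t₀| ≤ x.2 + 1 := by
  obtain ⟨σ, hσ, hne⟩ : ∃ σ ∈ Ioo (0 : ℝ) 1, weight (x.1 - σ * x.2 - t₀) ≠ 0 := by
    by_contra! hzero
    exact h (by rw [fanWeight, setLIntegral_congr_fun measurableSet_Ioo hzero, lintegral_zero])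
  have hmem : x.1 - σ * x.2 - t₀ ∈ Icc (-1 : ℝ) 1 := mem_of_indicator_ne_zero hne
  have h₁ : 0 ≤ σ * x.2 := mul_nonneg hσ.1.le hx.le
  have h₂ : σ * x.2 ≤ 1 * x.2 := by gcongr; exact hσ.2.le
  exact abs_le.2 ⟨by linarith [hmem.1], by linarith [hmem.2]⟩

theorem enorm_deriv_cutoff_mul_fanWeight_le {C : ℝ} (hC : ∀ y, ‖deriv cutoff y‖ ≤ C) (t₀ : ℝ)
    {x : ℝ × ℝ} (hx : 0 < x.2) :
    ‖deriv cutoff x.2‖ₑ * fanWeight t₀ x ≤ (Metric.closedBall (t₀, 0) 3).indicator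
      (fun _ => ENNReal.ofReal C * (1 + ∫⁻ s, weight s)) x := by
  by_cases hd : deriv cutoff x.2 = 0
  · simp [hd]
  by_cases hf : fanWeight t₀ x = 0
  · simp [hf]
  have h₁ : 1 ≤ x.2 := not_lt.1 fun hlt =>
    hd (deriv_cutoff_eq_zero_of_lt (by rwa [abs_of_pos hx]))
  have h₂ : x.2 ≤ 2 := not_lt.1 fun hlt =>
    hd (deriv_cutoff_eq_zero_of_gt (by rwa [abs_of_pos hx]))
  have hmem : x ∈ Metric.closedBall (t₀, 0) 3 := by
    rw [mem_closedBall_iff_norm, Prod.norm_def]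
    refine max_le ((abs_sub_le_of_fanWeight_ne_zero hx hf).trans (by linarith)) ?_
    rw [Prod.snd_sub, sub_zero, Real.norm_of_nonneg hx.le]
    linarith
  rw [indicator_of_mem hmem, ← ofReal_norm]
  gcongr
  · exact hC _
  · refine (fanWeight_le hx).trans (mul_le_of_le_one_left zero_le ?_)
    exact ENNReal.ofReal_le_one.2 (Real.rpow_le_one_of_one_le_of_nonpos h₁ (by norm_num))

theorem enorm_cutoff_mul_fanWeight_le (t₀ : ℝ) {x : ℝ × ℝ} (hx : 0 < x.2) :
    ‖cutoff x.2‖ₑ * fanWeight t₀ x ≤ (univ ×ˢ Ioc 0 2).indicator (fanWeight t₀) x := by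
  by_cases h₂ : x.2 ≤ 2
  · rw [indicator_of_mem (show x ∈ univ ×ˢ Ioc 0 2 from ⟨mem_univ _, hx, h₂⟩)]
    exact mul_le_of_le_one_left zero_le (enorm_cutoff_le_one _)
  · simp [cutoff_eq_zero ((not_le.1 h₂).le.trans (le_abs_self _))]

theorem lintegral_mul_lt_top_of_sq {α : Type*} [MeasurableSpace α] {μ : Measure α}
    {f g : α → ENNReal} (hf : AEMeasurable f μ) (hff : ∫⁻ x, f x * f x ∂μ < ⊤)
    (hgg : ∫⁻ x, g x * g x ∂μ < ⊤) : ∫⁻ x, f x * g x ∂μ < ⊤ := by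
  have hle (a b : ENNReal) : a * b ≤ a * a + b * b := by
    rcases le_total a b with h | h
    · exact (mul_le_mul_left h b).trans le_add_self
    · exact (mul_le_mul_right h a).trans le_self_add
  refine (lintegral_mono fun x => hle _ _).trans_lt ?_
  rw [lintegral_add_left' (hf.fun_mul hf)]
  exact ENNReal.add_lt_top.2 ⟨hff, hgg⟩

theorem GreenOn.lintegral_trace_mul_weight_lt_top (h : GreenOn upper (0, -1) w g p)
    (hg : MemLp g 2 (volume.restrict upper)) (t₀ : ℝ) :
    ∫⁻ t, ‖p t‖ₑ * weight (t - t₀) < ⊤ := by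
  obtain ⟨C, hC⟩ := exists_norm_deriv_cutoff_le
  set c := ENNReal.ofReal C * (1 + ∫⁻ s, weight s)
  have hc : c < ⊤ := ENNReal.mul_lt_top ENNReal.ofReal_lt_top
    (ENNReal.add_lt_top.2 ⟨ENNReal.one_lt_top, lintegral_weight_lt_top⟩)
  set B := Metric.closedBall ((t₀, 0) : ℝ × ℝ) 3
  have hB : MeasurableSet B := Metric.isClosed_closedBall.measurableSet
  set S : Set (ℝ × ℝ) := univ ×ˢ Ioc 0 2
  have hS : MeasurableSet S := MeasurableSet.univ.prod measurableSet_Ioc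
  have hw : AEMeasurable (fun x => ‖w x‖ₑ) (volume.restrict upper) :=
    h.locallyIntegrable.aestronglyMeasurable.enorm
  have hw_lt : ∫⁻ x in upper, ‖w x‖ₑ * B.indicator (fun _ => c) x < ⊤ := by
    simp only [← indicator_mul_right _ fun x => ‖w x‖ₑ]
    rw [lintegral_indicator hB, lintegral_mul_const'' _ hw.restrict]
    exact ENNReal.mul_lt_top
      (h.locallyIntegrable.integrableOn_isCompact (isCompact_closedBall _ _)).2 hc
  have hg_lt : ∫⁻ x in upper, ‖g x‖ₑ * S.indicator (fanWeight t₀) x < ⊤ := by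
    refine lintegral_mul_lt_top_of_sq h.locallyIntegrable_grad.aestronglyMeasurable.enorm ?_ ?_
    · simpa [pow_two] using
        lintegral_rpow_enorm_lt_top_of_eLpNorm_lt_top (p := 2) (by simp) (by simp) hg.2
    · simp only [← indicator_mul]
      refine (setLIntegral_le_lintegral _ _).trans_lt ?_
      rw [lintegral_indicator hS]
      exact lintegral_fanWeight_sq_lt_top t₀ zero_le_two
  refine (h.lintegral_trace_mul_weight_le t₀).trans_lt ?_
  calc ∫⁻ x in upper, traceMajorant w g x * fanWeight t₀ x
      ≤ ∫⁻ x in upper, (‖w x‖ₑ * B.indicator (fun _ => c) x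
          + 2 * (‖g x‖ₑ * S.indicator (fanWeight t₀) x)) := by
        refine setLIntegral_mono' isOpen_upper.measurableSet fun x hx => ?_
        rw [traceMajorant, add_mul, mul_assoc, mul_assoc, mul_assoc]
        gcongr
        exacts [enorm_deriv_cutoff_mul_fanWeight_le hC t₀ hx, enorm_cutoff_mul_fanWeight_le t₀ hx]
    _ < ⊤ := by
        rw [lintegral_add_left' (hw.fun_mul (measurable_const.indicator hB).aemeasurable),
          lintegral_const_mul' _ _ (by simp)]
        exact ENNReal.add_lt_top.2 ⟨hw_lt, ENNReal.mul_lt_top (by simp) hg_lt⟩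

end WeightedTraces

/-! ### The inverse Joukowski map -/

open scoped ComplexConjugate
open Complex (I sqrt slitPlane)

theorem sqrt_sq (z : ℂ) : sqrt z ^ 2 = z := by simp [sqrt]

theorem sqrt_mul_self (z : ℂ) : sqrt z * sqrt z = z := by rw [← pow_two, sqrt_sq]

theorem sqrt_ne_zero {z : ℂ} (hz : z ≠ 0) : sqrt z ≠ 0 := fun h =>
  hz (by rw [← sqrt_sq z, h, zero_pow two_ne_zero])

theorem norm_sqrt_sq (z : ℂ) : ‖sqrt z‖ ^ 2 = ‖z‖ := by rw [← norm_pow, sqrt_sq]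

theorem sqrt_re_nonneg (z : ℂ) : 0 ≤ (sqrt z).re := by
  rw [sqrt, Complex.cpow_inv_two_re]
  positivity

theorem sqrt_im_nonneg {z : ℂ} (h : 0 ≤ z.im) : 0 ≤ (sqrt z).im := by
  rw [sqrt, Complex.cpow_inv_two_im_eq_sqrt h]
  positivity

theorem sqrt_im_nonpos {z : ℂ} (h : z.im < 0) : (sqrt z).im ≤ 0 := by
  rw [sqrt, Complex.cpow_inv_two_im_eq_neg_sqrt h]
  exact neg_nonpos.2 (Real.sqrt_nonneg _)

theorem sqrt_ofReal {t : ℝ} (ht : 0 ≤ t) : sqrt (t : ℂ) = (√t : ℝ) := by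
  simpa using RCLike.sqrt_of_nonneg (𝕜 := ℂ) (a := t) (by simpa using ht)

theorem sqrt_ofReal_of_nonpos {t : ℝ} (ht : t ≤ 0) : sqrt (t : ℂ) = (√(-t) : ℝ) * I := by
  have h := Complex.sqrt_neg_of_nonneg (Complex.zero_le_real.2 (neg_nonneg.2 ht))
  rwa [sqrt_ofReal (neg_nonneg.2 ht), Complex.ofReal_neg, neg_neg, mul_comm] at h

theorem hasDerivAt_sqrt {z : ℂ} (hz : z ∈ slitPlane) :
    HasDerivAt sqrt (1 / (2 * sqrt z)) z := by
  refine (Complex.hasDerivAt_sqrt hz).congr_deriv ?_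
  rw [neg_div, Complex.cpow_neg, one_div (2 : ℂ), ← sqrt]
  field_simp

theorem sqrt_conj {z : ℂ} (hz : z ∈ slitPlane) : sqrt (conj z) = conj (sqrt z) := by
  have h := Complex.conj_cpow z (2⁻¹ : ℂ) (Complex.slitPlane_arg_ne_pi hz)
  simpa [sqrt, map_ofNat] using h

theorem continuousOn_sqrt : ContinuousOn sqrt {z | 0 ≤ z.im} := by
  have h : Continuous fun z : ℂ => (√((‖z‖ + z.re) / 2) : ℂ) + √((‖z‖ - z.re) / 2) * I := by
    fun_prop
  refine h.continuousOn.congr fun z (hz : 0 ≤ z.im) => ?_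
  rw [Complex.sqrt_eq_real_add_ite, if_pos hz, one_mul]

/-- The branch `√z - √(z - 1)` of the inverse of the Joukowski map `X ↦ (X + X⁻¹) / 2`, evaluated
at `√z`; it maps the complement of the crack into the unit disk. -/
noncomputable def joukowskiInv (z : ℂ) : ℂ := sqrt z - sqrt (z - 1)

/-- The derivative of `joukowskiInv`. -/
noncomputable def joukowskiInvDeriv (z : ℂ) : ℂ := -joukowskiInv z / (2 * sqrt z * sqrt (z - 1))

theorem joukowskiInv_mul (z : ℂ) : joukowskiInv z * (sqrt z + sqrt (z - 1)) = 1 := by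
  unfold joukowskiInv
  linear_combination sqrt_mul_self z - sqrt_mul_self (z - 1)

theorem joukowskiInv_ne_zero (z : ℂ) : joukowskiInv z ≠ 0 :=
  left_ne_zero_of_mul (by rw [joukowskiInv_mul]; exact one_ne_zero)

theorem inv_joukowskiInv (z : ℂ) : (joukowskiInv z)⁻¹ = sqrt z + sqrt (z - 1) :=
  inv_eq_of_mul_eq_one_right (joukowskiInv_mul z)

theorem joukowskiInv_add_inv (z : ℂ) : (joukowskiInv z + (joukowskiInv z)⁻¹) / 2 = sqrt z := by
  rw [inv_joukowskiInv, joukowskiInv]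
  ring

theorem norm_add_norm_sub_one_le (z : ℂ) : ‖z‖ + ‖z - 1‖ ≤ ‖sqrt z + sqrt (z - 1)‖ ^ 2 := by
  -- `√z` and `√(z - 1)` lie in a common closed quadrant.
  have hre := mul_nonneg (sqrt_re_nonneg z) (sqrt_re_nonneg (z - 1))
  have him : 0 ≤ (sqrt z).im * (sqrt (z - 1)).im := by
    rcases le_or_gt 0 z.im with hz | hz
    · exact mul_nonneg (sqrt_im_nonneg hz) (sqrt_im_nonneg (by simpa using hz))
    · exact mul_nonneg_of_nonpos_of_nonpos (sqrt_im_nonpos hz)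
        (sqrt_im_nonpos (by simpa using hz))
  rw [← norm_sqrt_sq z, ← norm_sqrt_sq (z - 1)]
  simp only [← Complex.normSq_eq_norm_sq, Complex.normSq_apply, Complex.add_re, Complex.add_im]
  linarith

theorem norm_joukowskiInv_sq_mul_le (z : ℂ) : ‖joukowskiInv z‖ ^ 2 * (‖z‖ + ‖z - 1‖) ≤ 1 := by
  calc ‖joukowskiInv z‖ ^ 2 * (‖z‖ + ‖z - 1‖)
      ≤ ‖joukowskiInv z‖ ^ 2 * ‖sqrt z + sqrt (z - 1)‖ ^ 2 := by
        gcongr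
        exact norm_add_norm_sub_one_le z
    _ = 1 := by rw [← mul_pow, ← norm_mul, joukowskiInv_mul]; simp

theorem one_le_norm_add_norm_sub_one (z : ℂ) : 1 ≤ ‖z‖ + ‖z - 1‖ :=
  calc (1 : ℝ) = ‖z - (z - 1)‖ := by simp
    _ ≤ _ := norm_sub_le _ _

theorem norm_joukowskiInv_le_one (z : ℂ) : ‖joukowskiInv z‖ ≤ 1 :=
  (sq_le_one_iff₀ (norm_nonneg _)).1 ((le_mul_of_one_le_right (sq_nonneg _)
    (one_le_norm_add_norm_sub_one z)).trans (norm_joukowskiInv_sq_mul_le z))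

theorem mem_slitPlane_of_sub_one {z : ℂ} (hz : z - 1 ∈ slitPlane) : z ∈ slitPlane := by
  rw [Complex.mem_slitPlane_iff] at *
  exact hz.imp (fun h => by simp at h; linarith) fun h => by simpa using h

theorem hasDerivAt_joukowskiInv {z : ℂ} (hz : z - 1 ∈ slitPlane) :
    HasDerivAt joukowskiInv (joukowskiInvDeriv z) z := by
  have hz' := mem_slitPlane_of_sub_one hz
  have h₀ := sqrt_ne_zero (Complex.slitPlane_ne_zero hz)
  have h₁ := sqrt_ne_zero (Complex.slitPlane_ne_zero hz')
  refine ((hasDerivAt_sqrt hz').sub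
    (HasDerivAt.comp_sub_const z 1 (hasDerivAt_sqrt hz))).congr_deriv ?_
  rw [joukowskiInvDeriv, joukowskiInv]
  field_simp
  ring

theorem sqrt_conj_sub_one {z : ℂ} (hz : z - 1 ∈ slitPlane) :
    sqrt (conj z - 1) = conj (sqrt (z - 1)) := by
  rw [← sqrt_conj hz, map_sub, map_one]

theorem joukowskiInv_conj {z : ℂ} (hz : z - 1 ∈ slitPlane) :
    joukowskiInv (conj z) = conj (joukowskiInv z) := by
  rw [joukowskiInv, joukowskiInv, sqrt_conj (mem_slitPlane_of_sub_one hz), sqrt_conj_sub_one hz,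
    map_sub]

theorem joukowskiInvDeriv_conj {z : ℂ} (hz : z - 1 ∈ slitPlane) :
    joukowskiInvDeriv (conj z) = conj (joukowskiInvDeriv z) := by
  rw [joukowskiInvDeriv, joukowskiInvDeriv, sqrt_conj (mem_slitPlane_of_sub_one hz),
    sqrt_conj_sub_one hz, joukowskiInv_conj hz]
  simp [map_ofNat]

theorem continuousOn_sqrt_sub_one : ContinuousOn (fun z => sqrt (z - 1)) {z | 0 ≤ z.im} :=
  continuousOn_sqrt.comp (by fun_prop) fun z hz => by simpa using hz

theorem continuousOn_joukowskiInv : ContinuousOn joukowskiInv {z | 0 ≤ z.im} :=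
  continuousOn_sqrt.sub continuousOn_sqrt_sub_one

theorem continuousOn_joukowskiInvDeriv :
    ContinuousOn joukowskiInvDeriv ({z | 0 ≤ z.im} ∩ {z | z ≠ 0 ∧ z ≠ 1}) :=
  (continuousOn_joukowskiInv.mono inter_subset_left).neg.div
    ((continuousOn_const.mul (continuousOn_sqrt.mono inter_subset_left)).mul
      (continuousOn_sqrt_sub_one.mono inter_subset_left)) fun _ hz =>
    mul_ne_zero (mul_ne_zero two_ne_zero (sqrt_ne_zero hz.2.1))
      (sqrt_ne_zero (sub_ne_zero.2 hz.2.2))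

theorem norm_joukowskiInvDeriv_sq (z : ℂ) :
    ‖joukowskiInvDeriv z‖ ^ 2 = ‖joukowskiInv z‖ ^ 2 / (4 * ‖z‖ * ‖z - 1‖) := by
  rw [joukowskiInvDeriv, norm_div, norm_neg, norm_mul, norm_mul, div_pow, mul_pow, mul_pow,
    norm_sqrt_sq, norm_sqrt_sq]
  norm_num

/-! ### An odd polynomial -/

section Polynomial
open Polynomial (aeval derivative)

theorem norm_aeval_le_eval_norm {p : Polynomial ℝ} (hp : ∀ i, 0 ≤ p.coeff i) (z : ℂ) :
    ‖aeval z p‖ ≤ p.eval ‖z‖ := by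
  rw [Polynomial.aeval_eq_sum_range, Polynomial.eval_eq_sum_range]
  refine norm_sum_le_of_le _ fun i _ => ?_
  rw [norm_smul, norm_pow, Real.norm_of_nonneg (hp i)]

theorem eval_le_eval_of_coeff_nonneg {p : Polynomial ℝ} (hp : ∀ i, 0 ≤ p.coeff i) {r s : ℝ}
    (hr : 0 ≤ r) (hrs : r ≤ s) : p.eval r ≤ p.eval s := by
  rw [Polynomial.eval_eq_sum_range, Polynomial.eval_eq_sum_range]
  exact Finset.sum_le_sum fun i _ => mul_le_mul_of_nonneg_left (pow_le_pow_left₀ hr hrs i) (hp i)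

/-- The odd polynomial `L` with `L(X) + L(X⁻¹) = 2 ((X + X⁻¹) / 2) ^ (2m + 1)`, obtained by keeping
the positive powers in the binomial expansion of the right-hand side. -/
noncomputable def oddPoly (m : ℕ) : Polynomial ℝ :=
  ∑ i ∈ Finset.range (m + 1),
    Polynomial.monomial (2 * i + 1) (((2 * m + 1).choose (m - i) : ℝ) / 4 ^ m)

variable (m : ℕ)

theorem aeval_oddPoly (X : ℂ) : aeval X (oddPoly m)
    = ∑ i ∈ Finset.range (m + 1), ((2 * m + 1).choose (m - i) : ℂ) / 4 ^ m * X ^ (2 * i + 1) := by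
  simp [oddPoly, Polynomial.aeval_monomial]

theorem aeval_oddPoly_add_inv {X : ℂ} (hX : X ≠ 0) :
    aeval X (oddPoly m) + aeval X⁻¹ (oddPoly m) = 2 * ((X + X⁻¹) / 2) ^ (2 * m + 1) := by
  have hpow : (2 : ℂ) * ((X + X⁻¹) / 2) ^ (2 * m + 1) = (X + X⁻¹) ^ (2 * m + 1) / 4 ^ m := by
    rw [div_pow, pow_succ 2, pow_mul 2]
    norm_num
    field_simp
  rw [hpow, add_pow, show 2 * m + 1 + 1 = (m + 1) + (m + 1) by ring, Finset.sum_range_add, add_div,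
    add_comm (aeval X _), aeval_oddPoly, aeval_oddPoly, ← Finset.sum_range_reflect, Finset.sum_div,
    Finset.sum_div]
  congr 1 <;> refine Finset.sum_congr rfl fun i hi => ?_ <;>
    have him : i ≤ m := Nat.lt_succ_iff.1 (Finset.mem_range.1 hi)
  · have hcancel : X ^ i * X⁻¹ ^ (2 * m + 1 - i) = X⁻¹ ^ (2 * (m - i) + 1) := by
      rw [show 2 * m + 1 - i = i + (2 * (m - i) + 1) by omega, pow_add X⁻¹ i, ← mul_assoc,
        ← mul_pow, mul_inv_cancel₀ hX, one_pow, one_mul]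
    rw [show m + 1 - 1 - i = m - i by omega, show m - (m - i) = i by omega, hcancel]
    ring
  · have hcancel : X ^ (m + 1 + i) * X⁻¹ ^ (m - i) = X ^ (2 * i + 1) := by
      rw [show m + 1 + i = (2 * i + 1) + (m - i) by omega, pow_add, mul_assoc, ← mul_pow,
        mul_inv_cancel₀ hX, one_pow, mul_one]
    rw [← Nat.choose_symm (show m + 1 + i ≤ 2 * m + 1 by omega),
      show 2 * m + 1 - (m + 1 + i) = m - i by omega, hcancel]
    ring

theorem aeval_derivative_oddPoly_sub_inv {X : ℂ} (hX : X ≠ 0) :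
    X * aeval X (derivative (oddPoly m)) - X⁻¹ * aeval X⁻¹ (derivative (oddPoly m))
      = (2 * m + 1 : ℕ) * ((X + X⁻¹) / 2) ^ (2 * m) * (X - X⁻¹) := by
  have hleft : HasDerivAt (fun Y => aeval Y (oddPoly m) + aeval Y⁻¹ (oddPoly m))
      (aeval X (derivative (oddPoly m)) + aeval X⁻¹ (derivative (oddPoly m)) * (-(X ^ 2)⁻¹)) X :=
    ((oddPoly m).hasDerivAt_aeval X).add
      (((oddPoly m).hasDerivAt_aeval X⁻¹).comp X (hasDerivAt_inv hX))
  have hright : HasDerivAt (fun Y : ℂ => 2 * ((Y + Y⁻¹) / 2) ^ (2 * m + 1))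
      (2 * ((2 * m + 1 : ℕ) * ((X + X⁻¹) / 2) ^ (2 * m) * ((1 + -(X ^ 2)⁻¹) / 2))) X :=
    ((((hasDerivAt_id X).add (hasDerivAt_inv hX)).div_const 2).pow (2 * m + 1)).const_mul 2
  have hderiv := hleft.unique (hright.congr_of_eventuallyEq
    ((isOpen_ne.eventually_mem hX).mono fun Y hY => aeval_oddPoly_add_inv m hY))
  calc X * aeval X (derivative (oddPoly m)) - X⁻¹ * aeval X⁻¹ (derivative (oddPoly m))
      = X * (aeval X (derivative (oddPoly m))
          + aeval X⁻¹ (derivative (oddPoly m)) * (-(X ^ 2)⁻¹)) := by field_simp; ring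
    _ = _ := by rw [hderiv]; field_simp; ring

theorem aeval_neg_oddPoly (X : ℂ) : aeval (-X) (oddPoly m) = -aeval X (oddPoly m) := by
  simp only [aeval_oddPoly, ← Finset.sum_neg_distrib, Odd.neg_pow ⟨_, rfl⟩, mul_neg]

theorem aeval_neg_derivative_oddPoly (X : ℂ) :
    aeval (-X) (derivative (oddPoly m)) = aeval X (derivative (oddPoly m)) := by
  simp [oddPoly, Polynomial.aeval_monomial]

theorem coeff_oddPoly_nonneg (i : ℕ) : 0 ≤ (oddPoly m).coeff i := by
  rw [oddPoly, Polynomial.finsetSum_coeff]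
  refine Finset.sum_nonneg fun j _ => ?_
  rw [Polynomial.coeff_monomial]
  positivity

theorem coeff_derivative_oddPoly_nonneg (i : ℕ) : 0 ≤ (derivative (oddPoly m)).coeff i := by
  rw [Polynomial.coeff_derivative]
  exact mul_nonneg (coeff_oddPoly_nonneg m _) (by positivity)

theorem eval_derivative_oddPoly_pos {r : ℝ} (hr : 0 ≤ r) :
    0 < (derivative (oddPoly m)).eval r := by
  have hzero : 0 < (derivative (oddPoly m)).eval 0 := by
    have : 0 < ((2 * m + 1).choose m : ℝ) := by exact_mod_cast Nat.choose_pos (by omega)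
    rw [← Polynomial.coeff_zero_eq_eval_zero, Polynomial.coeff_derivative, oddPoly,
      Polynomial.finsetSum_coeff]
    simpa [Polynomial.coeff_monomial] using this
  exact hzero.trans_le (eval_le_eval_of_coeff_nonneg (coeff_derivative_oddPoly_nonneg m) le_rfl hr)

/-- `L'(1)`, which bounds `L(X) / X` and `L'(X)` on the unit disk. -/
noncomputable def oddPolyBound : ℝ := (derivative (oddPoly m)).eval 1

theorem oddPolyBound_pos : 0 < oddPolyBound m := eval_derivative_oddPoly_pos m zero_le_one

theorem norm_aeval_derivative_oddPoly_le {X : ℂ} (hX : ‖X‖ ≤ 1) :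
    ‖aeval X (derivative (oddPoly m))‖ ≤ oddPolyBound m :=
  have hcoeff := coeff_derivative_oddPoly_nonneg m
  (norm_aeval_le_eval_norm hcoeff X).trans
    (eval_le_eval_of_coeff_nonneg hcoeff (norm_nonneg X) hX)

theorem norm_aeval_oddPoly_le {X : ℂ} (hX : ‖X‖ ≤ 1) :
    ‖aeval X (oddPoly m)‖ ≤ oddPolyBound m * ‖X‖ := by
  have h := (convex_closedBall (0 : ℂ) 1).norm_image_sub_le_of_norm_hasDerivWithin_le
    (x := 0) (y := X)
    (fun Y _ => ((oddPoly m).hasDerivAt_aeval Y).hasDerivWithinAt)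
    (fun Y hY => norm_aeval_derivative_oddPoly_le m (by simpa using hY))
    (by simp) (by simpa using hX)
  simpa [aeval_oddPoly] using h

end Polynomial

/-! ### The holomorphic function off the crack -/

section CrackFun
open Polynomial (aeval derivative)

variable (m : ℕ)

/-- `F = L(√z - √(z - 1))`, holomorphic off the half-line `(-∞, 1]`. The minimisers and their
conjugates are real parts of multiples of `F`. -/
noncomputable def crackFun (z : ℂ) : ℂ := aeval (joukowskiInv z) (oddPoly m)

/-- The derivative of `crackFun`. -/
noncomputable def crackFunDeriv (z : ℂ) : ℂ :=
  aeval (joukowskiInv z) (derivative (oddPoly m)) * joukowskiInvDeriv z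

theorem hasDerivAt_crackFun {z : ℂ} (hz : z - 1 ∈ slitPlane) :
    HasDerivAt (crackFun m) (crackFunDeriv m z) z :=
  ((oddPoly m).hasDerivAt_aeval (joukowskiInv z)).comp z (hasDerivAt_joukowskiInv hz)

theorem continuousOn_crackFun : ContinuousOn (crackFun m) {z | 0 ≤ z.im} :=
  (oddPoly m).continuous_aeval.comp_continuousOn continuousOn_joukowskiInv

theorem continuousOn_crackFunDeriv :
    ContinuousOn (crackFunDeriv m) ({z | 0 ≤ z.im} ∩ {z | z ≠ 0 ∧ z ≠ 1}) :=
  ((derivative (oddPoly m)).continuous_aeval.comp_continuousOn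
    (continuousOn_joukowskiInv.mono inter_subset_left)).mul continuousOn_joukowskiInvDeriv

theorem crackFun_conj {z : ℂ} (hz : z - 1 ∈ slitPlane) :
    crackFun m (conj z) = conj (crackFun m z) := by
  rw [crackFun, joukowskiInv_conj hz, Polynomial.aeval_conj, crackFun]

theorem crackFunDeriv_conj {z : ℂ} (hz : z - 1 ∈ slitPlane) :
    crackFunDeriv m (conj z) = conj (crackFunDeriv m z) := by
  rw [crackFunDeriv, joukowskiInv_conj hz, joukowskiInvDeriv_conj hz, Polynomial.aeval_conj,
    crackFunDeriv, map_mul]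

theorem norm_crackFun_le (z : ℂ) : ‖crackFun m z‖ ≤ oddPolyBound m :=
  (norm_aeval_oddPoly_le m (norm_joukowskiInv_le_one z)).trans
    (mul_le_of_le_one_right (oddPolyBound_pos m).le (norm_joukowskiInv_le_one z))

theorem norm_crackFun_sq_mul_le (z : ℂ) :
    ‖crackFun m z‖ ^ 2 * (‖z‖ + ‖z - 1‖) ≤ oddPolyBound m ^ 2 := by
  calc ‖crackFun m z‖ ^ 2 * (‖z‖ + ‖z - 1‖)
      ≤ (oddPolyBound m * ‖joukowskiInv z‖) ^ 2 * (‖z‖ + ‖z - 1‖) := by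
        gcongr
        exact norm_aeval_oddPoly_le m (norm_joukowskiInv_le_one z)
    _ = oddPolyBound m ^ 2 * (‖joukowskiInv z‖ ^ 2 * (‖z‖ + ‖z - 1‖)) := by ring
    _ ≤ oddPolyBound m ^ 2 * 1 := by
        gcongr
        exact norm_joukowskiInv_sq_mul_le z
    _ = _ := mul_one _

/-- Up to a constant, `poleBound` bounds `‖F'‖²`: it has simple poles at the two singular points
and decays like `‖z‖⁻³`, hence is integrable over the plane. -/
noncomputable def poleBound (z : ℂ) : ℝ := (‖z‖⁻¹ + ‖z - 1‖⁻¹) / (‖z‖ + ‖z - 1‖) ^ 2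

theorem poleBound_nonneg (z : ℂ) : 0 ≤ poleBound z := by
  unfold poleBound
  positivity

theorem norm_joukowskiInvDeriv_sq_le (z : ℂ) : ‖joukowskiInvDeriv z‖ ^ 2 ≤ poleBound z := by
  have hs : 0 < ‖z‖ + ‖z - 1‖ := zero_lt_one.trans_le (one_le_norm_add_norm_sub_one z)
  have hsq : ‖joukowskiInv z‖ ^ 2 ≤ 1 / (‖z‖ + ‖z - 1‖) :=
    (le_div_iff₀ hs).2 (norm_joukowskiInv_sq_mul_le z)
  rw [norm_joukowskiInvDeriv_sq]
  rcases eq_or_ne z 0 with rfl | hz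
  · simpa using poleBound_nonneg 0
  rcases eq_or_ne z 1 with rfl | hz'
  · simpa using poleBound_nonneg 1
  have hz₁ : z - 1 ≠ 0 := sub_ne_zero.2 hz'
  calc ‖joukowskiInv z‖ ^ 2 / (4 * ‖z‖ * ‖z - 1‖)
      ≤ (1 / (‖z‖ + ‖z - 1‖)) / (1 * ‖z‖ * ‖z - 1‖) := by gcongr; norm_num
    _ = poleBound z := by
        unfold poleBound
        field_simp
        ring

theorem norm_crackFunDeriv_le (z : ℂ) :
    ‖crackFunDeriv m z‖ ≤ oddPolyBound m * √(poleBound z) := by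
  rw [crackFunDeriv, norm_mul]
  gcongr
  · exact (oddPolyBound_pos m).le
  · exact norm_aeval_derivative_oddPoly_le m (norm_joukowskiInv_le_one z)
  · exact Real.le_sqrt_of_sq_le (norm_joukowskiInvDeriv_sq_le z)

/-! ### Boundary values on the axis -/

section BoundaryValues

variable {t : ℝ}

theorem sqrt_pow_eq_rpow (ht : 0 ≤ t) (k : ℕ) : √t ^ k = t ^ ((k : ℝ) / 2) := by
  rw [Real.sqrt_eq_rpow, ← Real.rpow_mul_natCast ht]
  congr 1
  ring

theorem sqrt_ofReal_sub_one_of_le (ht : t ≤ 1) : sqrt ((t : ℂ) - 1) = (√(1 - t) : ℝ) * I := by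
  rw [← neg_sub t 1, ← sqrt_ofReal_of_nonpos (sub_nonpos.2 ht)]
  push_cast
  rfl

theorem sqrt_ofReal_sub_one_of_ge (ht : 1 ≤ t) : sqrt ((t : ℂ) - 1) = (√(t - 1) : ℝ) := by
  rw [← sqrt_ofReal (sub_nonneg.2 ht)]
  push_cast
  rfl

theorem joukowskiInv_ofReal_of_ge (ht : 1 ≤ t) : joukowskiInv t = (√t - √(t - 1) : ℝ) := by
  rw [joukowskiInv, sqrt_ofReal (by linarith), sqrt_ofReal_sub_one_of_ge ht, Complex.ofReal_sub]

theorem joukowskiInv_ofReal_of_mem (ht : t ∈ Icc 0 1) :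
    joukowskiInv t = (√t : ℝ) - (√(1 - t) : ℝ) * I := by
  rw [joukowskiInv, sqrt_ofReal ht.1, sqrt_ofReal_sub_one_of_le ht.2]

/-- On the segment `[0, 1]` the boundary values lie on the unit circle. -/
theorem inv_joukowskiInv_ofReal_of_mem (ht : t ∈ Icc 0 1) :
    (joukowskiInv t)⁻¹ = conj (joukowskiInv t) := by
  rw [inv_joukowskiInv, joukowskiInv_ofReal_of_mem ht, sqrt_ofReal ht.1,
    sqrt_ofReal_sub_one_of_le ht.2]
  simp

theorem joukowskiInv_ofReal_of_nonpos (ht : t ≤ 0) :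
    joukowskiInv t = (√(-t) - √(1 - t) : ℝ) * I := by
  rw [joukowskiInv, sqrt_ofReal_of_nonpos ht, sqrt_ofReal_sub_one_of_le (by linarith)]
  push_cast
  ring

theorem conj_joukowskiInv_of_nonpos (ht : t ≤ 0) :
    conj (joukowskiInv t) = -joukowskiInv t := by
  rw [joukowskiInv_ofReal_of_nonpos ht]
  simp

theorem conj_joukowskiInv_of_ge (ht : 1 ≤ t) : conj (joukowskiInv t) = joukowskiInv t := by
  rw [joukowskiInv_ofReal_of_ge ht, Complex.conj_ofReal]

theorem crackFun_im_of_ge (ht : 1 ≤ t) : (crackFun m t).im = 0 := by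
  rw [← Complex.conj_eq_iff_im, crackFun, ← Polynomial.aeval_conj, conj_joukowskiInv_of_ge ht]

theorem crackFun_re_of_nonpos (ht : t ≤ 0) : (crackFun m t).re = 0 := by
  have h : conj (crackFun m t) = -crackFun m t := by
    rw [crackFun, ← Polynomial.aeval_conj, conj_joukowskiInv_of_nonpos ht, aeval_neg_oddPoly]
  have hre : (crackFun m t).re = -(crackFun m t).re := congrArg Complex.re h
  linarith

theorem crackFun_re_of_mem (ht : t ∈ Icc 0 1) :
    (crackFun m t).re = t ^ (((2 * m + 1 : ℕ) : ℝ) / 2) := by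
  have h := aeval_oddPoly_add_inv m (joukowskiInv_ne_zero t)
  rw [joukowskiInv_add_inv, inv_joukowskiInv_ofReal_of_mem ht, Polynomial.aeval_conj,
    Complex.add_conj, sqrt_ofReal ht.1, ← Complex.ofReal_pow, sqrt_pow_eq_rpow ht.1] at h
  exact_mod_cast mul_left_cancel₀ two_ne_zero (by exact_mod_cast h)

theorem crackFunDeriv_im_of_ge (ht : 1 ≤ t) : (crackFunDeriv m t).im = 0 := by
  rw [← Complex.conj_eq_iff_im, crackFunDeriv, joukowskiInvDeriv]
  simp only [map_mul, map_div₀, map_neg, map_ofNat, ← Polynomial.aeval_conj,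
    conj_joukowskiInv_of_ge ht, sqrt_ofReal (zero_le_one.trans ht), sqrt_ofReal_sub_one_of_ge ht,
    Complex.conj_ofReal]

theorem crackFunDeriv_re_of_nonpos (ht : t ≤ 0) : (crackFunDeriv m t).re = 0 := by
  have h : conj (crackFunDeriv m t) = -crackFunDeriv m t := by
    rw [crackFunDeriv, joukowskiInvDeriv, sqrt_ofReal_of_nonpos ht,
      sqrt_ofReal_sub_one_of_le (ht.trans zero_le_one)]
    simp only [map_mul, map_div₀, map_neg, map_ofNat, ← Polynomial.aeval_conj,
      conj_joukowskiInv_of_nonpos ht, aeval_neg_derivative_oddPoly, Complex.conj_ofReal,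
      Complex.conj_I]
    ring
  have hre : (crackFunDeriv m t).re = -(crackFunDeriv m t).re := congrArg Complex.re h
  linarith

theorem im_joukowskiInv_mul_aeval_derivative (ht : t ∈ Icc 0 1) :
    (joukowskiInv t * aeval (joukowskiInv t) (derivative (oddPoly m))).im
      = -((2 * m + 1 : ℕ) * √t ^ (2 * m) * √(1 - t)) := by
  have h := aeval_derivative_oddPoly_sub_inv m (joukowskiInv_ne_zero t)
  have him : (joukowskiInv t).im = -√(1 - t) := by simp [joukowskiInv_ofReal_of_mem ht]
  rw [joukowskiInv_add_inv, inv_joukowskiInv_ofReal_of_mem ht, Polynomial.aeval_conj, ← map_mul,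
    Complex.sub_conj, Complex.sub_conj, sqrt_ofReal ht.1, him, ← mul_assoc] at h
  have h' := mul_right_cancel₀ Complex.I_ne_zero h
  rw [← mul_neg]
  refine mul_left_cancel₀ (two_ne_zero (α := ℝ)) ?_
  rw [mul_left_comm]
  exact_mod_cast h'

theorem crackFunDeriv_re_of_mem (ht : t ∈ Ioo 0 1) : (crackFunDeriv m t).re
    = ((2 * m + 1 : ℕ) : ℝ) / 2 * t ^ (((2 * m + 1 : ℕ) : ℝ) / 2 - 1) := by
  have hs : 0 < √t := Real.sqrt_pos.2 ht.1
  have hr : 0 < √(1 - t) := Real.sqrt_pos.2 (sub_pos.2 ht.2)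
  have hderiv : crackFunDeriv m t = ((1 / (2 * √t * √(1 - t)) : ℝ) : ℂ) *
      (I * (joukowskiInv t * aeval (joukowskiInv t) (derivative (oddPoly m)))) := by
    rw [crackFunDeriv, joukowskiInvDeriv, sqrt_ofReal ht.1.le, sqrt_ofReal_sub_one_of_le ht.2.le]
    have hs' : (√t : ℂ) ≠ 0 := Complex.ofReal_ne_zero.2 hs.ne'
    have hr' : (√(1 - t) : ℂ) ≠ 0 := Complex.ofReal_ne_zero.2 hr.ne'
    push_cast
    field_simp
    rw [Complex.I_sq]
    ring
  have hpow : √t ^ (2 * m + 1) / t = √t ^ (2 * m) / √t := by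
    rw [div_eq_div_iff ht.1.ne' hs.ne', pow_succ, mul_assoc, Real.mul_self_sqrt ht.1.le]
  rw [hderiv, Complex.re_ofReal_mul, Complex.I_mul_re,
    im_joukowskiInv_mul_aeval_derivative m (Ioo_subset_Icc_self ht), Real.rpow_sub ht.1,
    Real.rpow_one, ← sqrt_pow_eq_rpow ht.1.le, hpow]
  field_simp

theorem crackFunDeriv_ofReal_ne_zero (ht : 1 < t) : crackFunDeriv m t ≠ 0 := by
  have ht₀ : (t : ℂ) ≠ 0 := Complex.ofReal_ne_zero.2 (by linarith)
  have ht₁ : (t : ℂ) - 1 ≠ 0 := by exact_mod_cast (sub_pos.2 ht).ne'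
  refine mul_ne_zero ?_ (div_ne_zero (neg_ne_zero.2 (joukowskiInv_ne_zero t))
    (mul_ne_zero (mul_ne_zero two_ne_zero (sqrt_ne_zero ht₀)) (sqrt_ne_zero ht₁)))
  have hr : 0 ≤ √t - √(t - 1) := sub_nonneg.2 (Real.sqrt_le_sqrt (by linarith))
  rw [joukowskiInv_ofReal_of_ge ht.le, ← Complex.coe_algebraMap,
    Polynomial.aeval_algebraMap_apply, Complex.coe_algebraMap, Complex.ofReal_ne_zero,
    Polynomial.coe_aeval_eq_eval]
  exact (eval_derivative_oddPoly_pos m hr).ne'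

end BoundaryValues

end CrackFun

/-! ### Harmonic functions in the plane -/

/-- The identification of the plane `ℝ × ℝ` with `ℂ`. -/
def toComplex (x : ℝ × ℝ) : ℂ := ⟨x.1, x.2⟩

theorem toComplex_axis (t : ℝ) : toComplex (t, 0) = t := rfl

theorem toComplex_reflect (x : ℝ × ℝ) : toComplex (reflect x) = conj (toComplex x) := by
  rw [reflect_apply]
  rfl

theorem equivRealProdCLM_symm_eq : ⇑Complex.equivRealProdCLM.symm = toComplex :=
  funext fun x => Complex.ext (by simp [toComplex]) (by simp [toComplex])

theorem continuous_toComplex : Continuous toComplex :=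
  equivRealProdCLM_symm_eq ▸ Complex.equivRealProdCLM.symm.continuous

theorem toComplex_ne_ofReal {x : ℝ × ℝ} {a : ℝ} (h : x ≠ (a, 0)) : toComplex x ≠ a :=
  fun h' => h (Prod.ext (congrArg Complex.re h') (congrArg Complex.im h'))

theorem toComplex_sub_one_mem_slitPlane {x : ℝ × ℝ} (hx : x ∈ crackᶜ) :
    toComplex x - 1 ∈ slitPlane := by
  rw [Complex.mem_slitPlane_iff]
  by_contra! h
  exact hx ⟨by simpa [toComplex] using h.1, by simpa [toComplex] using h.2⟩

theorem norm_le_norm_toComplex (x : ℝ × ℝ) : ‖x‖ ≤ ‖toComplex x‖ :=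
  max_le (Complex.abs_re_le_norm (toComplex x)) (Complex.abs_im_le_norm (toComplex x))

section Potential

variable (m : ℕ) (β : ℂ)

/-- The harmonic function `Re (β F)`. -/
noncomputable def potential (x : ℝ × ℝ) : ℝ := (β * crackFun m (toComplex x)).re

/-- The gradient of `potential` off the crack, read off from `β F'`. -/
noncomputable def potentialGrad (x : ℝ × ℝ) : ℝ × ℝ :=
  ((β * crackFunDeriv m (toComplex x)).re, -(β * crackFunDeriv m (toComplex x)).im)

theorem hasFDerivAt_potential {x : ℝ × ℝ} (hx : x ∈ crackᶜ) :
    HasFDerivAt (potential m β) (dotCLM (potentialGrad m β x)) x := by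
  have hF := ((hasDerivAt_crackFun m (toComplex_sub_one_mem_slitPlane hx)).const_mul
    β).hasFDerivAt.restrictScalars ℝ
  have hz : HasFDerivAt toComplex (Complex.equivRealProdCLM.symm : (ℝ × ℝ) →L[ℝ] ℂ) x :=
    equivRealProdCLM_symm_eq ▸ Complex.equivRealProdCLM.symm.hasFDerivAt
  refine (Complex.reCLM.hasFDerivAt.comp x (hF.comp x hz)).congr_fderiv ?_
  ext <;> simp [dotCLM_apply, dot, potentialGrad]

theorem continuousOn_potential : ContinuousOn (potential m β) {x | 0 ≤ x.2} :=
  Complex.continuous_re.comp_continuousOn (continuousOn_const.mul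
    ((continuousOn_crackFun m).comp continuous_toComplex.continuousOn fun _ hx => hx))

theorem continuousOn_potentialGrad :
    ContinuousOn (potentialGrad m β) ({x | 0 ≤ x.2} ∩ {x | x ≠ (0, 0) ∧ x ≠ (1, 0)}) := by
  have h : ContinuousOn (fun x => β * crackFunDeriv m (toComplex x))
      ({x | 0 ≤ x.2} ∩ {x | x ≠ (0, 0) ∧ x ≠ (1, 0)}) :=
    continuousOn_const.mul ((continuousOn_crackFunDeriv m).comp continuous_toComplex.continuousOn
      fun x hx => ⟨hx.1, by simpa using toComplex_ne_ofReal hx.2.1,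
        by simpa using toComplex_ne_ofReal hx.2.2⟩)
  exact (Complex.continuous_re.comp_continuousOn h).prodMk
    (Complex.continuous_im.comp_continuousOn h).neg

theorem norm_potential_le (x : ℝ × ℝ) :
    ‖potential m β x‖ ≤ ‖β‖ * ‖crackFun m (toComplex x)‖ := by
  rw [← norm_mul]
  exact Complex.abs_re_le_norm _

theorem norm_potential_le_const (x : ℝ × ℝ) : ‖potential m β x‖ ≤ ‖β‖ * oddPolyBound m :=
  (norm_potential_le m β x).trans (by gcongr; exact norm_crackFun_le m _)

theorem measurable_sqrt : Measurable sqrt := measurable_id.pow_const _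

theorem measurable_joukowskiInv : Measurable joukowskiInv :=
  measurable_sqrt.sub (measurable_sqrt.comp (measurable_id.sub_const 1))

theorem measurable_crackFun : Measurable (crackFun m) :=
  (oddPoly m).continuous_aeval.measurable.comp measurable_joukowskiInv

theorem measurable_crackFunDeriv : Measurable (crackFunDeriv m) :=
  ((Polynomial.derivative (oddPoly m)).continuous_aeval.measurable.comp
    measurable_joukowskiInv).mul (measurable_joukowskiInv.neg.div
      ((measurable_sqrt.const_mul 2).mul (measurable_sqrt.comp (measurable_id.sub_const 1))))

theorem measurable_potential : Measurable (potential m β) :=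
  Complex.measurable_re.comp
    (((measurable_crackFun m).comp continuous_toComplex.measurable).const_mul β)

theorem measurable_potentialGrad : Measurable (potentialGrad m β) := by
  have h := ((measurable_crackFunDeriv m).comp continuous_toComplex.measurable).const_mul β
  exact (Complex.measurable_re.comp h).prodMk (Complex.measurable_im.comp h).neg

theorem locallyIntegrable_potential : LocallyIntegrable (potential m β) :=
  (locallyIntegrable_const (‖β‖ * oddPolyBound m)).mono
    (measurable_potential m β).aestronglyMeasurable (Eventually.of_forall fun x =>
      (norm_potential_le_const m β x).trans (Real.le_norm_self _))

end Potential

/-! ### Square integrability of the gradient -/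

theorem inv_norm_div_sq_le (x : ℝ × ℝ) : ‖x‖⁻¹ / (1 + ‖x‖) ^ 2
    ≤ (Metric.closedBall 0 1).indicator (fun x : ℝ × ℝ => ‖x‖⁻¹) x
      + 2 * (1 + ‖x‖) ^ (-3 : ℝ) := by
  have h₀ := norm_nonneg x
  rcases le_or_gt ‖x‖ 1 with h | h
  · rw [indicator_of_mem (mem_closedBall_zero_iff.2 h)]
    refine le_add_of_le_of_nonneg (div_le_self (by positivity) ?_) (by positivity)
    nlinarith
  · rw [indicator_of_notMem (by simpa using h), zero_add]
    have hinv : ‖x‖⁻¹ ≤ 2 * (1 + ‖x‖)⁻¹ := by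
      rw [← div_eq_mul_inv, inv_le_iff_one_le_mul₀ (by linarith), div_mul_eq_mul_div,
        le_div_iff₀ (by linarith)]
      linarith
    calc ‖x‖⁻¹ / (1 + ‖x‖) ^ 2 ≤ 2 * (1 + ‖x‖)⁻¹ / (1 + ‖x‖) ^ 2 := by gcongr
      _ = 2 * (1 + ‖x‖) ^ (-3 : ℝ) := by
        rw [Real.rpow_neg (by linarith), show (3 : ℝ) = (3 : ℕ) by norm_num, Real.rpow_natCast]
        field_simp

theorem integrable_inv_norm_div_sq :
    Integrable fun x : ℝ × ℝ => ‖x‖⁻¹ / (1 + ‖x‖) ^ 2 := by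
  have hloc : LocallyIntegrable fun x : ℝ × ℝ => ‖x‖⁻¹ :=
    locallyIntegrable_of_norm_le_rpow (C := 1) (α := 1) (by simp) (by simp)
      (Eventually.of_forall fun x => by rw [one_mul, Real.rpow_neg_one, norm_inv, norm_norm])
      (by fun_prop : Measurable _).aestronglyMeasurable
  have hball : Integrable ((Metric.closedBall 0 1).indicator fun x : ℝ × ℝ => ‖x‖⁻¹) :=
    (integrable_indicator_iff measurableSet_closedBall).2
      (hloc.integrableOn_isCompact (isCompact_closedBall _ _))
  have htail : Integrable fun x : ℝ × ℝ => (1 + ‖x‖) ^ (-3 : ℝ) :=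
    integrable_one_add_norm (by norm_num)
  refine (hball.add (htail.const_mul 2)).mono'
    (by fun_prop : Measurable _).aestronglyMeasurable (Eventually.of_forall fun x => ?_)
  rw [Real.norm_of_nonneg (by positivity)]
  exact inv_norm_div_sq_le x

theorem inv_norm_toComplex_div_sq_le {x : ℝ × ℝ} {s : ℝ} (hx : x ≠ 0) (hs₁ : 1 ≤ s)
    (hs : ‖toComplex x‖ ≤ s) : ‖toComplex x‖⁻¹ / s ^ 2 ≤ 4 * (‖x‖⁻¹ / (1 + ‖x‖) ^ 2) := by
  have h := norm_le_norm_toComplex x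
  have _ : 0 < ‖x‖ := norm_pos_iff.2 hx
  calc ‖toComplex x‖⁻¹ / s ^ 2 ≤ ‖x‖⁻¹ / ((1 + ‖x‖) / 2) ^ 2 := by gcongr; linarith
    _ = _ := by field_simp; norm_num

theorem measurable_poleBound : Measurable fun x => poleBound (toComplex x) := by
  have h := continuous_toComplex.measurable
  unfold poleBound
  fun_prop

theorem integrable_poleBound : Integrable fun x => poleBound (toComplex x) := by
  have h := integrable_inv_norm_div_sq
  refine ((h.const_mul 4).add ((h.comp_sub_right (1, 0)).const_mul 4)).mono'
    measurable_poleBound.aestronglyMeasurable ?_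
  filter_upwards [ae_snd_ne 0] with x hx
  have hs := one_le_norm_add_norm_sub_one (toComplex x)
  have hshift : toComplex x - 1 = toComplex (x - (1, 0)) := rfl
  rw [Real.norm_of_nonneg (poleBound_nonneg _), poleBound, add_div]
  refine add_le_add ?_ ?_
  · exact inv_norm_toComplex_div_sq_le (fun h => hx (congrArg Prod.snd h)) hs
      (by linarith [norm_nonneg (toComplex x - 1)])
  · rw [hshift] at hs ⊢
    refine inv_norm_toComplex_div_sq_le (fun h => hx ?_) hs
      (by linarith [norm_nonneg (toComplex x)])
    simpa using congrArg Prod.snd h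

section GradMajorant

variable (m : ℕ)

/-- A square integrable majorant of `‖F'‖`. -/
noncomputable def gradMajorant (x : ℝ × ℝ) : ℝ := oddPolyBound m * √(poleBound (toComplex x))

theorem gradMajorant_nonneg (x : ℝ × ℝ) : 0 ≤ gradMajorant m x :=
  mul_nonneg (oddPolyBound_pos m).le (Real.sqrt_nonneg _)

theorem memLp_gradMajorant : MemLp (gradMajorant m) 2 := by
  have hmeas : Measurable (gradMajorant m) := measurable_poleBound.sqrt.const_mul _
  rw [memLp_two_iff_integrable_sq hmeas.aestronglyMeasurable]
  refine (integrable_poleBound.const_mul (oddPolyBound m ^ 2)).congr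
    (Eventually.of_forall fun x => ?_)
  simp only [gradMajorant, mul_pow, Real.sq_sqrt (poleBound_nonneg _)]

theorem norm_potentialGrad_le_norm_crackFunDeriv (β : ℂ) (x : ℝ × ℝ) :
    ‖potentialGrad m β x‖ ≤ ‖β‖ * ‖crackFunDeriv m (toComplex x)‖ := by
  rw [← norm_mul]
  exact max_le (Complex.abs_re_le_norm _) ((norm_neg _).trans_le (Complex.abs_im_le_norm _))

theorem norm_potentialGrad_le (β : ℂ) (x : ℝ × ℝ) :
    ‖potentialGrad m β x‖ ≤ ‖β‖ * gradMajorant m x :=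
  (norm_potentialGrad_le_norm_crackFunDeriv m β x).trans
    (mul_le_mul_of_nonneg_left (norm_crackFunDeriv_le m _) (norm_nonneg β))

theorem memLp_potentialGrad (β : ℂ) : MemLp (potentialGrad m β) 2 :=
  ((memLp_gradMajorant m).const_mul ‖β‖).mono (measurable_potentialGrad m β).aestronglyMeasurable
    (Eventually.of_forall fun x => (norm_potentialGrad_le m β x).trans (Real.le_norm_self _))

theorem locallyIntegrable_potentialGrad (β : ℂ) : LocallyIntegrable (potentialGrad m β) :=
  (memLp_potentialGrad m β).locallyIntegrable one_le_two

end GradMajorant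

/-! ### Classical functions -/

section ClassicalFunctions

variable {U V : Set (ℝ × ℝ)} {u φ : ℝ × ℝ → ℝ} {g : ℝ × ℝ → ℝ × ℝ} {x : ℝ × ℝ}

theorem hasFDerivAt_mul_test (hu : HasFDerivAt u (dotCLM (g x)) x) (hφ : IsTestOn V φ) :
    HasFDerivAt (fun x => u x * φ x) (u x • fderiv ℝ φ x + φ x • dotCLM (g x)) x :=
  hu.fun_mul hφ.differentiable.differentiableAt.hasFDerivAt

theorem hasFDerivAt_zero_of_notMem_tsupport {E : Type*} [NormedAddCommGroup E] [NormedSpace ℝ E]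
    {f : E → ℝ} {x : E} (hx : x ∉ tsupport f) : HasFDerivAt f (0 : E →L[ℝ] ℝ) x :=
  (hasFDerivAt_const (0 : ℝ) x).congr_of_eventuallyEq (notMem_tsupport_iff_eventuallyEq.1 hx)

theorem smul_fderiv_add_smul_dotCLM_apply (e : ℝ × ℝ) :
    (u x • fderiv ℝ φ x + φ x • dotCLM (g x)) e = u x * fderiv ℝ φ x e + dot (g x) e * φ x := by
  simp [dotCLM_apply, dot_comm e, mul_comm]

theorem hasWeakGrad_of_hasFDerivAt (hu : ∀ x ∈ U, HasFDerivAt u (dotCLM (g x)) x)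
    (hul : LocallyIntegrableOn u U) (hgl : LocallyIntegrableOn g U) : HasWeakGrad U u g := by
  refine ⟨hul, hgl, fun φ hφ e => ?_⟩
  have hi₁ := (hφ.fderiv e).integrable_mul hul
  have hi₂ := hφ.integrable_mul (locallyIntegrableOn_dot_const hgl e)
  have hd (x : ℝ × ℝ) :
      HasFDerivAt (fun x => u x * φ x) (u x • fderiv ℝ φ x + φ x • dotCLM (g x)) x := by
    by_cases hx : x ∈ U
    · exact hasFDerivAt_mul_test (hu x hx) hφ
    · have hxφ : x ∉ tsupport φ := fun h => hx (hφ.2.2 h)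
      have hzero : x ∉ tsupport fun x => u x * φ x := fun h => hxφ (tsupport_mul_subset_right h)
      rw [image_eq_zero_of_notMem_tsupport hxφ, (hasFDerivAt_zero_of_notMem_tsupport hxφ).fderiv,
        smul_zero, zero_smul, add_zero]
      exact hasFDerivAt_zero_of_notMem_tsupport hzero
  have hfd (x : ℝ × ℝ) :
      fderiv ℝ (fun x => u x * φ x) x e = u x * fderiv ℝ φ x e + dot (g x) e * φ x := by
    rw [(hd x).fderiv, smul_fderiv_add_smul_dotCLM_apply]
  have hint := integral_mul_fderiv_eq_neg_fderiv_mul_of_integrable (μ := volume) (𝕜 := ℝ)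
    (f := fun _ : ℝ × ℝ => (1 : ℝ)) (g := fun x => u x * φ x) (v := e) (by simp)
    (by simpa only [hfd, one_mul] using hi₁.fun_add hi₂)
    (by simpa only [one_mul] using hφ.integrable_mul hul)
    (fun x _ => differentiableAt_const _) (fun x _ => (hd x).differentiableAt)
  simp only [hfd, one_mul, fderiv_fun_const, Pi.zero_apply, zero_apply,
    zero_mul, integral_zero, neg_zero] at hint
  rw [integral_add hi₁ hi₂] at hint
  rw [(hφ.fderiv e).setIntegral_mul, hφ.setIntegral_mul]
  exact eq_neg_of_add_eq_zero_left hint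

section DivergenceTheorem

variable {F : ℝ × ℝ → ℝ} {F' : ℝ × ℝ → ℝ × ℝ →L[ℝ] ℝ} {e : ℝ × ℝ}

theorem setIntegral_halfBox_fderiv {R : ℝ} (hR : 0 < R) (hF : ∀ x, R ≤ ‖x‖ → F x = 0)
    (hd : ∀ x ∈ upper, HasFDerivAt F (F' x) x) (hc : ContinuousOn F {x | 0 ≤ x.2})
    (hi : IntegrableOn (fun x => F' x e) (Icc (-R, 0) (R, R))) :
    ∫ x in Icc (-R, 0) (R, R), F' x e = -(e.2 * ∫ t, F (t, 0)) := by
  have hside (s : ℝ) : F (R, s) = 0 ∧ F (-R, s) = 0 ∧ F (s, R) = 0 := by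
    refine ⟨hF _ ?_, hF _ ?_, hF _ ?_⟩ <;> simp [Prod.norm_def, abs_of_pos hR]
  have haxis : ∫ t in -R..R, F (t, 0) = ∫ t, F (t, 0) := by
    refine intervalIntegral.integral_eq_integral_of_support_subset fun t ht => ?_
    have htR : |t| < R := lt_of_not_ge fun h => ht (hF _ (h.trans (norm_fst_le (t, (0 : ℝ)))))
    exact ⟨(abs_lt.1 htR).1, (abs_lt.1 htR).2.le⟩
  have hdir (x : ℝ × ℝ) : e.1 * F' x (1, 0) + e.2 * F' x (0, 1) = F' x e := by
    rw [← smul_eq_mul, ← smul_eq_mul, ← map_smul, ← map_smul, ← map_add]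
    simp
  have hcb : ContinuousOn F (Icc (-R, 0) (R, R)) := hc.mono fun x hx => hx.1.2
  have hdb : ∀ x ∈ Ioo (-R) R ×ˢ Ioo 0 R, HasFDerivAt F (F' x) x := fun x hx => hd x hx.2.1
  have hdiv := integral_divergence_prod_Icc_of_hasFDerivAt_of_le (fun x => e.1 • F x)
    (fun x => e.2 • F x) (fun x => e.1 • F' x) (fun x => e.2 • F' x) (-R, 0) (R, R)
    ⟨by simpa using hR.le, hR.le⟩ (continuousOn_const.fun_smul hcb)
    (continuousOn_const.fun_smul hcb) (fun x hx => (hdb x hx).fun_const_smul _)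
    (fun x hx => (hdb x hx).fun_const_smul _)
    (by simpa only [smul_apply, smul_eq_mul, hdir] using hi)
  simpa [hdir, haxis, hside] using hdiv

theorem setIntegral_upper_fderiv (hd : ∀ x ∈ upper, HasFDerivAt F (F' x) x)
    (hc : ContinuousOn F {x | 0 ≤ x.2}) (hs : HasCompactSupport F)
    (hi : IntegrableOn (fun x => F' x e) upper) :
    ∫ x in upper, F' x e = -(e.2 * ∫ t, F (t, 0)) := by
  obtain ⟨R, hR₀, hR⟩ := hs.isCompact.isBounded.subset_ball_lt 0 0
  have hF {x : ℝ × ℝ} (hx : R ≤ ‖x‖) : x ∉ tsupport F := fun h =>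
    hx.not_gt (mem_ball_zero_iff.1 (hR h))
  set box := Icc ((-R, 0) : ℝ × ℝ) (R, R)
  have hbox_ae : (box ∩ upper : Set (ℝ × ℝ)) =ᵐ[volume] box := by
    filter_upwards [ae_snd_ne 0] with x hx
    exact propext (and_iff_left_of_imp fun h => lt_of_le_of_ne h.1.2 hx.symm)
  have hzero : ∀ x ∈ upper \ (box ∩ upper), F' x e = 0 := by
    rintro x ⟨hxu, hx⟩
    have hxR : R ≤ ‖x‖ := by
      by_contra! h
      have h₁ := abs_lt.1 ((norm_fst_le x).trans_lt h)
      have h₂ := abs_lt.1 ((norm_snd_le x).trans_lt h)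
      exact hx ⟨⟨⟨h₁.1.le, le_of_lt hxu⟩, h₁.2.le, h₂.2.le⟩, hxu⟩
    rw [(hd x hxu).unique (hasFDerivAt_zero_of_notMem_tsupport (hF hxR)), zero_apply]
  rw [setIntegral_eq_of_subset_of_forall_sdiff_eq_zero isOpen_upper.measurableSet
    inter_subset_right hzero, setIntegral_congr_set hbox_ae]
  exact setIntegral_halfBox_fderiv hR₀ (fun x hx => image_eq_zero_of_notMem_tsupport (hF hx)) hd hc
    ((hi.mono_set inter_subset_right).congr_set_ae hbox_ae.symm)

end DivergenceTheorem

theorem greenOn_of_hasFDerivAt (hu : ∀ x ∈ upper, HasFDerivAt u (dotCLM (g x)) x)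
    (hc : ContinuousOn u {x | 0 ≤ x.2}) (hul : LocallyIntegrable u (volume.restrict upper))
    (hgl : LocallyIntegrable g (volume.restrict upper)) :
    GreenOn upper (0, -1) u g (fun t => u (t, 0)) where
  locallyIntegrable_trace :=
    (hc.comp_continuous (by fun_prop) fun _ => le_refl (0 : ℝ)).locallyIntegrable
  locallyIntegrable := hul
  locallyIntegrable_grad := hgl
  green φ hφ e := by
    have hi₁ := (hφ.fderiv e).integrable_mul' hul
    have hi₂ := hφ.integrable_mul' (locallyIntegrable_dot_const hgl e)
    have hgreen := setIntegral_upper_fderiv (fun x hx => hasFDerivAt_mul_test (hu x hx) hφ)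
      (hc.mul hφ.continuous.continuousOn) hφ.2.1.mul_left (e := e)
      (by simpa only [IntegrableOn, smul_fderiv_add_smul_dotCLM_apply] using hi₁.fun_add hi₂)
    simp only [smul_fderiv_add_smul_dotCLM_apply] at hgreen
    rw [integral_add hi₁ hi₂] at hgreen
    rw [show dot (0, -1) e = -e.2 by simp [dot], neg_mul, ← hgreen]
    ring

end ClassicalFunctions

theorem weight_of_abs_le_one {s : ℝ} (hs : |s| ≤ 1) : weight s = ENNReal.ofReal (√|s|)⁻¹ := by
  rw [weight, indicator_of_mem (show s ∈ Icc (-1) 1 from abs_le.1 hs),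
    Real.rpow_neg (abs_nonneg s), Real.sqrt_eq_rpow]

theorem enorm_inv_sqrt_le (s : ℝ) : ‖(√|s|)⁻¹‖ₑ ≤ weight s + 1 := by
  rw [Real.enorm_of_nonneg (by positivity)]
  rcases le_or_gt |s| 1 with hs | hs
  · exact (weight_of_abs_le_one hs).ge.trans le_self_add
  · refine le_add_left (ENNReal.ofReal_le_one.2 ?_)
    exact inv_le_one_of_one_le₀ (Real.one_le_sqrt.2 hs.le)

theorem integrable_mul_of_hasCompactSupport {p a : ℝ → ℝ} (hp : LocallyIntegrable p)
    (ha : Continuous a) (hc : HasCompactSupport a) : Integrable fun t => p t * a t := by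
  simpa [mul_comm] using hp.integrable_smul_left_of_hasCompactSupport ha hc

theorem GreenOn.integrable_trace_mul_inv_sqrt {w : ℝ × ℝ → ℝ} {g : ℝ × ℝ → ℝ × ℝ} {p a : ℝ → ℝ}
    (h : GreenOn upper (0, -1) w g p) (hg : MemLp g 2 (volume.restrict upper)) (t₀ : ℝ)
    (ha : Continuous a) (hc : HasCompactSupport a) :
    Integrable fun t => p t * a t * (√|t - t₀|)⁻¹ := by
  obtain ⟨C, hC⟩ := hc.exists_bound_of_continuous ha
  have hpa := integrable_mul_of_hasCompactSupport h.locallyIntegrable_trace ha hc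
  have hle (t : ℝ) : ‖p t * a t * (√|t - t₀|)⁻¹‖ₑ
      ≤ ENNReal.ofReal C * (‖p t‖ₑ * weight (t - t₀)) + ‖p t * a t‖ₑ := by
    have hCt : ‖a t‖ₑ ≤ ENNReal.ofReal C :=
      ofReal_norm (a t) ▸ ENNReal.ofReal_le_ofReal (hC t)
    calc ‖p t * a t * (√|t - t₀|)⁻¹‖ₑ ≤ ‖p t * a t‖ₑ * (weight (t - t₀) + 1) := by
          rw [enorm_mul]; gcongr; exact enorm_inv_sqrt_le _
      _ = ‖a t‖ₑ * (‖p t‖ₑ * weight (t - t₀)) + ‖p t * a t‖ₑ := by rw [enorm_mul]; ring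
      _ ≤ _ := by gcongr
  refine ⟨hpa.aestronglyMeasurable.mul (by fun_prop), (lintegral_mono hle).trans_lt ?_⟩
  rw [lintegral_add_right' _ hpa.aestronglyMeasurable.enorm, lintegral_const_mul' _ _ (by simp)]
  exact ENNReal.add_lt_top.2
    ⟨ENNReal.mul_lt_top (by simp) (h.lintegral_trace_mul_weight_lt_top hg t₀), hpa.2⟩

section RotGrad

variable {φ ψ : ℝ × ℝ → ℝ}

theorem IsTestOn.hasCompactSupport_axis {U : Set (ℝ × ℝ)} (hφ : IsTestOn U φ) :
    HasCompactSupport fun t : ℝ => φ (t, 0) :=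
  HasCompactSupport.intro (hφ.2.1.isCompact.image continuous_fst) fun t ht =>
    image_eq_zero_of_notMem_tsupport fun hx => ht ⟨(t, 0), hx, rfl⟩

theorem continuous_rotGrad (hψ : IsTestOn univ ψ) : Continuous (rotGrad ψ) :=
  (hψ.fderiv (0, 1)).continuous.prodMk (hψ.fderiv (1, 0)).continuous.neg

theorem rotGrad_eq_zero {x : ℝ × ℝ} (hx : x ∉ tsupport ψ) : rotGrad ψ x = 0 := by
  simp [rotGrad, fderiv_of_notMem_tsupport (𝕜 := ℝ) hx]

theorem memLp_rotGrad (hψ : IsTestOn univ ψ) : MemLp (rotGrad ψ) 2 :=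
  (continuous_rotGrad hψ).memLp_of_hasCompactSupport <|
    HasCompactSupport.intro hψ.2.1.isCompact fun _ hx => rotGrad_eq_zero hx

end RotGrad

theorem dot_sub_left (a b c : ℝ × ℝ) : dot (a - b) c = dot a c - dot b c := by
  simp only [dot, Prod.fst_sub, Prod.snd_sub]
  ring

theorem integrable_dot {f g : ℝ × ℝ → ℝ × ℝ} {μ : Measure (ℝ × ℝ)} (hf : MemLp f 2 μ)
    (hg : MemLp g 2 μ) : Integrable (fun x => dot (f x) (g x)) μ :=
  (hf.fst.integrable_mul hg.fst).add (hf.snd.integrable_mul hg.snd)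

theorem GreenOn.sub {H : Set (ℝ × ℝ)} {n : ℝ × ℝ} {w w' : ℝ × ℝ → ℝ} {g g' : ℝ × ℝ → ℝ × ℝ}
    {p p' : ℝ → ℝ} (h : GreenOn H n w g p) (h' : GreenOn H n w' g' p') :
    GreenOn H n (w - w') (g - g') (p - p') where
  locallyIntegrable_trace := h.locallyIntegrable_trace.sub h'.locallyIntegrable_trace
  locallyIntegrable := h.locallyIntegrable.sub h'.locallyIntegrable
  locallyIntegrable_grad := h.locallyIntegrable_grad.sub h'.locallyIntegrable_grad
  green φ hφ e := by
    have haxis : Continuous fun t : ℝ => φ (t, 0) := hφ.continuous.comp (by fun_prop)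
    simp only [Pi.sub_apply, dot_sub_left, sub_mul]
    rw [integral_sub ((hφ.fderiv e).integrable_mul' h.locallyIntegrable)
        ((hφ.fderiv e).integrable_mul' h'.locallyIntegrable),
      integral_sub (hφ.integrable_mul' (locallyIntegrable_dot_const h.locallyIntegrable_grad e))
        (hφ.integrable_mul' (locallyIntegrable_dot_const h'.locallyIntegrable_grad e)),
      integral_sub
        (integrable_mul_of_hasCompactSupport h.locallyIntegrable_trace haxis
          hφ.hasCompactSupport_axis)
        (integrable_mul_of_hasCompactSupport h'.locallyIntegrable_trace haxis
          hφ.hasCompactSupport_axis), h.green φ hφ e, h'.green φ hφ e]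
    ring

/-! ### Testing with the conjugate harmonic function -/

/-- A smooth cutoff in the vertical direction: `1` above height `-ε/4` and `0` below `-ε/2`. -/
noncomputable def verticalCutoff (ε y : ℝ) : ℝ := Real.smoothTransition (2 + 4 * y / ε)

theorem contDiff_verticalCutoff (ε : ℝ) :
    ContDiff ℝ ∞ fun x : ℝ × ℝ => verticalCutoff ε x.2 :=
  Real.smoothTransition.contDiff.comp (by fun_prop)

section VerticalCutoff

variable {ε y : ℝ}

theorem verticalCutoff_eq_one (hε : 0 < ε) (hy : -(ε / 4) ≤ y) : verticalCutoff ε y = 1 := by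
  refine Real.smoothTransition.one_of_one_le ?_
  rw [← sub_le_iff_le_add', le_div_iff₀ hε]
  linarith

theorem verticalCutoff_eq_zero (hε : 0 < ε) (hy : y ≤ -(ε / 2)) : verticalCutoff ε y = 0 := by
  refine Real.smoothTransition.zero_of_nonpos ?_
  rw [← le_neg_iff_add_nonpos_left, div_le_iff₀ hε]
  linarith

end VerticalCutoff

section Conjugate

variable (m : ℕ) (β : ℂ)

/-- The harmonic function `Im (β F)`. It is conjugate to `potential m β`, so that its rotated
gradient is `potentialGrad m β`. -/
noncomputable def conjugate : ℝ × ℝ → ℝ := potential m (-I * β)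

theorem conjugate_eq (x : ℝ × ℝ) : conjugate m β x = (β * crackFun m (toComplex x)).im := by
  simp [conjugate, potential, mul_assoc]

theorem norm_conjugate_le (x : ℝ × ℝ) :
    ‖conjugate m β x‖ ≤ ‖β‖ * ‖crackFun m (toComplex x)‖ := by
  simpa [conjugate] using norm_potential_le m (-I * β) x

theorem norm_conjugate_le_const (x : ℝ × ℝ) : ‖conjugate m β x‖ ≤ ‖β‖ * oddPolyBound m := by
  simpa [conjugate] using norm_potential_le_const m (-I * β) x

theorem contDiffAt_potential {x : ℝ × ℝ} (hx : x ∈ crackᶜ) : ContDiffAt ℝ ∞ (potential m β) x := by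
  have hopen : IsOpen {z : ℂ | z - 1 ∈ slitPlane} :=
    Complex.isOpen_slitPlane.preimage (by fun_prop)
  have hF : DifferentiableOn ℂ (crackFun m) {z | z - 1 ∈ slitPlane} := fun z hz =>
    (hasDerivAt_crackFun m hz).differentiableAt.differentiableWithinAt
  have hFx : ContDiffAt ℝ ∞ (crackFun m) (toComplex x) :=
    ((hF.contDiffOn hopen).contDiffAt
      (hopen.mem_nhds (toComplex_sub_one_mem_slitPlane hx))).restrict_scalars ℝ
  have htoComplex : ContDiff ℝ ∞ toComplex :=
    equivRealProdCLM_symm_eq ▸ Complex.equivRealProdCLM.symm.contDiff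
  exact Complex.reCLM.contDiff.contDiffAt.comp x
    (contDiffAt_const.mul (hFx.comp x htoComplex.contDiffAt))

variable (χ : ℝ × ℝ → ℝ) (ε : ℝ) (x : ℝ × ℝ)

/-- `χ Im (β F)`, with `F` shifted vertically by `ε` to make it smooth up to the axis, and cut off
below the axis. -/
noncomputable def shiftedConjugate : ℝ :=
  χ x * (verticalCutoff ε x.2 * conjugate m β (x + (0, ε)))

/-- The rotated gradient of `χ Im (β F)`, with `F` shifted by `ε`. For `ε = 0` this is the limit of
the rotated gradients of `shiftedConjugate m β χ ε`. -/
noncomputable def rotGradCut : ℝ × ℝ :=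
  conjugate m β (x + (0, ε)) • rotGrad χ x + χ x • potentialGrad m β (x + (0, ε))

variable {m β χ ε x}

theorem isTestOn_shiftedConjugate (hχ : IsTestOn univ χ) (hε : 0 < ε) :
    IsTestOn univ (shiftedConjugate m β χ ε) := by
  refine ⟨hχ.1.mul (contDiff_iff_contDiffAt.2 fun x => ?_), hχ.2.1.mul_right, subset_univ _⟩
  rcases lt_or_ge (-ε) x.2 with hx | hx
  · have hup : x + (0, ε) ∈ upper := show 0 < x.2 + ε by linarith
    exact (contDiff_verticalCutoff ε).contDiffAt.mul
      ((contDiffAt_potential m _ (upper_subset_compl_crack hup)).comp x (f := (· + (0, ε)))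
        (by fun_prop))
  · refine (contDiffAt_const (c := (0 : ℝ))).congr_of_eventuallyEq ?_
    filter_upwards [(isOpen_lt continuous_snd continuous_const).mem_nhds
      (show x.2 < -(ε / 2) by linarith)] with y hy
    rw [verticalCutoff_eq_zero hε (le_of_lt hy), zero_mul]

theorem rotGrad_shiftedConjugate (hχ : IsTestOn univ χ) (hε : 0 < ε) (hx : 0 ≤ x.2) :
    rotGrad (shiftedConjugate m β χ ε) x = rotGradCut m β χ ε x := by
  have hup : x + (0, ε) ∈ upper := show 0 < x.2 + ε by linarith
  have hconj : HasFDerivAt (fun y => conjugate m β (y + (0, ε)))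
      (dotCLM (potentialGrad m (-I * β) (x + (0, ε)))) x :=
    (hasFDerivAt_comp_add_right _).2
      (hasFDerivAt_potential m (-I * β) (upper_subset_compl_crack hup))
  have heq : shiftedConjugate m β χ ε =ᶠ[𝓝 x] fun y => χ y * conjugate m β (y + (0, ε)) := by
    filter_upwards [(isOpen_lt continuous_const continuous_snd).mem_nhds
      (show -(ε / 4) < x.2 by linarith)] with y hy
    rw [shiftedConjugate, verticalCutoff_eq_one hε (le_of_lt hy), one_mul]
  rw [rotGrad, heq.fderiv_eq,
    (hχ.differentiable.differentiableAt.hasFDerivAt.fun_mul hconj).fderiv]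
  ext <;> simp [rotGradCut, rotGrad, dotCLM_apply, dot, potentialGrad, mul_assoc] <;> ring

theorem measurable_rotGradCut (hχ : IsTestOn univ χ) : Measurable (rotGradCut m β χ ε) := by
  have hshift : Measurable fun x : ℝ × ℝ => x + (0, ε) := by fun_prop
  exact (((measurable_potential m _).comp hshift).smul (continuous_rotGrad hχ).measurable).add
    (hχ.continuous.measurable.smul ((measurable_potentialGrad m β).comp hshift))

theorem poleBound_shift_le (hx : 0 ≤ x.2) (h₀ : x ≠ (0, 0)) (h₁ : x ≠ (1, 0)) (hε : 0 ≤ ε) :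
    poleBound (toComplex (x + (0, ε))) ≤ poleBound (toComplex x) := by
  have hle (a : ℝ) : ‖toComplex x - a‖ ≤ ‖toComplex (x + (0, ε)) - a‖ := by
    rw [← sq_le_sq₀ (norm_nonneg _) (norm_nonneg _)]
    simp only [← Complex.normSq_eq_norm_sq, Complex.normSq_apply, toComplex, Complex.sub_re,
      Complex.sub_im, Complex.ofReal_re, Complex.ofReal_im, sub_zero, Prod.fst_add, Prod.snd_add,
      add_zero]
    nlinarith
  have hle₀ : ‖toComplex x‖ ≤ ‖toComplex (x + (0, ε))‖ := by simpa using hle 0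
  have hle₁ : ‖toComplex x - 1‖ ≤ ‖toComplex (x + (0, ε)) - 1‖ := by simpa using hle 1
  have hpos₀ : 0 < ‖toComplex x‖ := norm_pos_iff.2 (by simpa using toComplex_ne_ofReal h₀)
  have hpos₁ : 0 < ‖toComplex x - 1‖ :=
    norm_pos_iff.2 (sub_ne_zero.2 (by simpa using toComplex_ne_ofReal h₁))
  unfold poleBound
  gcongr

theorem norm_rotGradCut_le (hx : 0 ≤ x.2) (h₀ : x ≠ (0, 0)) (h₁ : x ≠ (1, 0)) (hε : 0 ≤ ε) :
    ‖rotGradCut m β χ ε x‖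
      ≤ ‖β‖ * (oddPolyBound m * ‖rotGrad χ x‖ + ‖χ x‖ * gradMajorant m x) := by
  have hgrad : ‖potentialGrad m β (x + (0, ε))‖ ≤ ‖β‖ * gradMajorant m x :=
    (norm_potentialGrad_le m β _).trans <| mul_le_mul_of_nonneg_left
      (mul_le_mul_of_nonneg_left (Real.sqrt_le_sqrt (poleBound_shift_le hx h₀ h₁ hε))
        (oddPolyBound_pos m).le) (norm_nonneg β)
  calc ‖rotGradCut m β χ ε x‖
      ≤ ‖conjugate m β (x + (0, ε))‖ * ‖rotGrad χ x‖
        + ‖χ x‖ * ‖potentialGrad m β (x + (0, ε))‖ := by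
        rw [← norm_smul, ← norm_smul]
        exact norm_add_le _ _
    _ ≤ ‖β‖ * oddPolyBound m * ‖rotGrad χ x‖ + ‖χ x‖ * (‖β‖ * gradMajorant m x) := by
        gcongr
        exact norm_conjugate_le_const m β _
    _ = _ := by ring

theorem gradMajorant_axis_le (t : ℝ) :
    gradMajorant m (t, 0) ≤ oddPolyBound m * ((√|t - 0|)⁻¹ + (√|t - 1|)⁻¹) := by
  have hnorm₀ : ‖toComplex (t, 0)‖ = |t - 0| := by simp [toComplex_axis]
  have hnorm₁ : ‖toComplex (t, 0) - 1‖ = |t - 1| := by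
    rw [toComplex_axis, ← Complex.ofReal_one, ← Complex.ofReal_sub, Complex.norm_real,
      Real.norm_eq_abs]
  have hsum := one_le_norm_add_norm_sub_one (toComplex (t, 0))
  have hpole : poleBound (toComplex (t, 0)) ≤ |t - 0|⁻¹ + |t - 1|⁻¹ := by
    rw [poleBound, hnorm₀, hnorm₁] at *
    exact div_le_self (by positivity) (one_le_pow₀ hsum)
  refine mul_le_mul_of_nonneg_left ?_ (oddPolyBound_pos m).le
  rw [← Real.sqrt_inv, ← Real.sqrt_inv]
  refine (Real.sqrt_le_sqrt hpole).trans (Real.sqrt_le_iff.2 ⟨by positivity, ?_⟩)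
  rw [add_sq, Real.sq_sqrt (by positivity), Real.sq_sqrt (by positivity)]
  exact add_le_add_left (le_add_of_nonneg_right (by positivity)) _

theorem tendsto_rotGradCut (hx : 0 ≤ x.2) (h₀ : x ≠ (0, 0)) (h₁ : x ≠ (1, 0)) :
    Tendsto (fun ε => rotGradCut m β χ ε x) (𝓝[>] 0) (𝓝 (rotGradCut m β χ 0 x)) := by
  have hx_add : x + (0, (0 : ℝ)) = x := add_zero x
  have hshift : Tendsto (fun ε : ℝ => x + (0, ε)) (𝓝[>] 0) (𝓝 (x + (0, 0))) :=
    (Continuous.tendsto (by fun_prop) 0).mono_left nhdsWithin_le_nhds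
  have hpos : ∀ᶠ ε : ℝ in 𝓝[>] 0, 0 < (x + (0, ε)).2 := by
    filter_upwards [self_mem_nhdsWithin] with ε hε using add_pos_of_nonneg_of_pos hx hε
  have hconj : Tendsto (fun ε => conjugate m β (x + (0, ε))) (𝓝[>] 0)
      (𝓝 (conjugate m β (x + (0, 0)))) :=
    (continuousOn_potential m _ _ (hx_add.symm ▸ hx)).tendsto.comp
      (tendsto_nhdsWithin_iff.2 ⟨hshift, hpos.mono fun _ => le_of_lt⟩)
  have hgrad : Tendsto (fun ε => potentialGrad m β (x + (0, ε))) (𝓝[>] 0)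
      (𝓝 (potentialGrad m β (x + (0, 0)))) := by
    refine (continuousOn_potentialGrad m β _ (hx_add.symm ▸ ⟨hx, h₀, h₁⟩)).tendsto.comp
      (tendsto_nhdsWithin_iff.2 ⟨hshift, hpos.mono fun ε h => ⟨h.le, ?_, ?_⟩⟩) <;>
    exact fun hx' => h.ne' (congrArg Prod.snd hx')
  exact (hconj.smul_const _).add (hgrad.const_smul _)

end Conjugate

section RotationIdentity

variable {m : ℕ} {β : ℂ} {w χ : ℝ × ℝ → ℝ} {g : ℝ × ℝ → ℝ × ℝ} {p : ℝ → ℝ}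

theorem aestronglyMeasurable_mul_rotGradCut (hp : LocallyIntegrable p) (hχ : IsTestOn univ χ)
    (ε : ℝ) : AEStronglyMeasurable fun t => p t * (rotGradCut m β χ ε (t, 0)).2 :=
  hp.aestronglyMeasurable.mul
    (measurable_snd.comp ((measurable_rotGradCut hχ).comp (by fun_prop))).aestronglyMeasurable

theorem GreenOn.exists_bound_trace_mul_rotGradCut (h : GreenOn upper (0, -1) w g p)
    (hg : MemLp g 2 (volume.restrict upper)) (hχ : IsTestOn univ χ) :
    ∃ B : ℝ → ℝ, Integrable B ∧ ∀ ε, 0 ≤ ε →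
      ∀ᵐ t, ‖p t * (rotGradCut m β χ ε (t, 0)).2‖ ≤ B t := by
  have haxis : Continuous fun t : ℝ => χ (t, 0) := hχ.continuous.comp (by fun_prop)
  have hrot : Continuous fun t : ℝ => ‖rotGrad χ (t, 0)‖ :=
    ((continuous_rotGrad hχ).comp (by fun_prop)).norm
  have hrot_supp : HasCompactSupport fun t : ℝ => ‖rotGrad χ (t, 0)‖ :=
    HasCompactSupport.intro (hχ.2.1.isCompact.image continuous_fst) fun t ht => by
      rw [rotGrad_eq_zero fun hx => ht ⟨(t, 0), hx, rfl⟩, norm_zero]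
  refine ⟨fun t => ‖β‖ * oddPolyBound m * (‖p t * ‖rotGrad χ (t, 0)‖‖
      + (‖p t * χ (t, 0) * (√|t - 0|)⁻¹‖ + ‖p t * χ (t, 0) * (√|t - 1|)⁻¹‖)),
    ((integrable_mul_of_hasCompactSupport h.locallyIntegrable_trace hrot hrot_supp).norm.add
      ((h.integrable_trace_mul_inv_sqrt hg 0 haxis hχ.hasCompactSupport_axis).norm.add
        (h.integrable_trace_mul_inv_sqrt hg 1 haxis hχ.hasCompactSupport_axis).norm)).const_mul _,
    fun ε hε => ?_⟩
  filter_upwards [Measure.ae_ne volume 0, Measure.ae_ne volume 1] with t h₀ h₁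
  have hcut := (norm_snd_le _).trans (norm_rotGradCut_le (m := m) (β := β) (χ := χ)
    (x := (t, 0)) (le_refl (0 : ℝ)) (by simpa using h₀) (by simpa using h₁) hε)
  calc ‖p t * (rotGradCut m β χ ε (t, 0)).2‖
      ≤ ‖p t‖ * (‖β‖ * (oddPolyBound m * ‖rotGrad χ (t, 0)‖
        + ‖χ (t, 0)‖ * (oddPolyBound m * ((√|t - 0|)⁻¹ + (√|t - 1|)⁻¹)))) := by
        rw [norm_mul]
        refine mul_le_mul_of_nonneg_left (hcut.trans ?_) (norm_nonneg _)
        gcongr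
        exact gradMajorant_axis_le t
    _ = _ := by
        simp only [norm_mul, norm_norm, norm_inv, Real.norm_of_nonneg (Real.sqrt_nonneg _)]
        ring

theorem GreenOn.integrable_trace_mul_rotGradCut (h : GreenOn upper (0, -1) w g p)
    (hg : MemLp g 2 (volume.restrict upper)) (hχ : IsTestOn univ χ) :
    Integrable fun t => p t * (rotGradCut m β χ 0 (t, 0)).2 :=
  let ⟨_, hB, hle⟩ := h.exists_bound_trace_mul_rotGradCut hg hχ
  hB.mono' (aestronglyMeasurable_mul_rotGradCut h.locallyIntegrable_trace hχ 0) (hle 0 le_rfl)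

theorem GreenOn.tendsto_integral_trace_mul_rotGradCut (h : GreenOn upper (0, -1) w g p)
    (hg : MemLp g 2 (volume.restrict upper)) (hχ : IsTestOn univ χ) :
    Tendsto (fun ε => ∫ t, p t * (rotGradCut m β χ ε (t, 0)).2) (𝓝[>] 0)
      (𝓝 (∫ t, p t * (rotGradCut m β χ 0 (t, 0)).2)) := by
  obtain ⟨B, hB, hle⟩ := h.exists_bound_trace_mul_rotGradCut hg hχ
  refine tendsto_integral_filter_of_dominated_convergence B
    (Eventually.of_forall fun ε =>
      aestronglyMeasurable_mul_rotGradCut h.locallyIntegrable_trace hχ ε)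
    (eventually_mem_nhdsWithin.mono fun ε hε => hle ε (le_of_lt hε)) hB ?_
  filter_upwards [Measure.ae_ne volume 0, Measure.ae_ne volume 1] with t h₀ h₁
  exact ((continuous_snd.tendsto _).comp (tendsto_rotGradCut (x := (t, 0)) (le_refl (0 : ℝ))
    (by simpa using h₀) (by simpa using h₁))).const_mul _

theorem tendsto_integral_dot_rotGradCut (hg : MemLp g 2 (volume.restrict upper))
    (hχ : IsTestOn univ χ) :
    Tendsto (fun ε => ∫ x in upper, dot (g x) (rotGradCut m β χ ε x)) (𝓝[>] 0)
      (𝓝 (∫ x in upper, dot (g x) (rotGradCut m β χ 0 x))) := by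
  obtain ⟨C, hC⟩ := hχ.exists_norm_le
  have hmeas (ε : ℝ) : AEStronglyMeasurable (rotGradCut m β χ ε) (volume.restrict upper) :=
    (measurable_rotGradCut hχ).aestronglyMeasurable
  refine tendsto_integral_filter_of_dominated_convergence (fun x => 2 * ‖β‖ *
      (oddPolyBound m * (‖g x‖ * ‖rotGrad χ x‖) + C * (‖g x‖ * gradMajorant m x)))
    (Eventually.of_forall fun ε => (hg.aestronglyMeasurable.fst.mul (hmeas ε).fst).add
      (hg.aestronglyMeasurable.snd.mul (hmeas ε).snd))
    ?_ ((((hg.norm.integrable_mul ((memLp_rotGrad hχ).restrict upper).norm).const_mul _).add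
      ((hg.norm.integrable_mul ((memLp_gradMajorant m).restrict upper)).const_mul _)).const_mul _)
    ?_
  · filter_upwards [self_mem_nhdsWithin] with ε hε
    filter_upwards [ae_restrict_mem isOpen_upper.measurableSet] with x hx
    have hne (a : ℝ) : x ≠ (a, 0) := fun h => axis_notMem_upper a (h ▸ hx)
    calc ‖dot (g x) (rotGradCut m β χ ε x)‖
        ≤ 2 * (‖g x‖ * ‖rotGradCut m β χ ε x‖) := abs_dot_le _ _
      _ ≤ 2 * (‖g x‖ * (‖β‖ * (oddPolyBound m * ‖rotGrad χ x‖ + C * gradMajorant m x))) := by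
          gcongr
          refine (norm_rotGradCut_le (le_of_lt hx) (hne 0) (hne 1) (le_of_lt hε)).trans ?_
          gcongr
          exacts [gradMajorant_nonneg m x, hC x]
      _ = _ := by ring
  · filter_upwards [ae_restrict_mem isOpen_upper.measurableSet] with x hx
    have hne (a : ℝ) : x ≠ (a, 0) := fun h => axis_notMem_upper a (h ▸ hx)
    have hdot : Continuous (dot (g x)) := by unfold dot; fun_prop
    exact (hdot.tendsto _).comp (tendsto_rotGradCut (le_of_lt hx) (hne 0) (hne 1))

theorem GreenOn.integral_dot_rotGradCut (h : GreenOn upper (0, -1) w g p)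
    (hg : MemLp g 2 (volume.restrict upper)) (hχ : IsTestOn univ χ) :
    ∫ x in upper, dot (g x) (rotGradCut m β χ 0 x)
      = -∫ t : ℝ, p t * (rotGradCut m β χ 0 (t, 0)).2 := by
  refine tendsto_nhds_unique (tendsto_integral_dot_rotGradCut hg hχ)
    ((h.tendsto_integral_trace_mul_rotGradCut hg hχ).neg.congr' ?_)
  filter_upwards [self_mem_nhdsWithin] with ε hε
  simp only [← rotGrad_shiftedConjugate (m := m) (β := β) hχ hε (x := (_, 0)) (le_refl (0 : ℝ))]
  rw [← h.integral_dot_rotGrad (isTestOn_shiftedConjugate hχ hε)]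
  refine setIntegral_congr_fun isOpen_upper.measurableSet fun x hx => ?_
  simp only [rotGrad_shiftedConjugate hχ hε (le_of_lt hx : 0 ≤ x.2)]

end RotationIdentity

/-! ### Removing the cutoff -/

/-- A smooth cutoff in the plane, equal to `1` on the unit square and supported in twice the
square. -/
noncomputable def planeCutoff : ContDiffBump (0 : ℝ × ℝ) := ⟨1, 2, one_pos, one_lt_two⟩

/-- The dilated cutoffs, which tend to `1` as `r` tends to `0`. -/
noncomputable def dilatedCutoff (r : ℝ) (x : ℝ × ℝ) : ℝ := planeCutoff (r • x)

theorem isTestOn_planeCutoff : IsTestOn univ planeCutoff :=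
  ⟨planeCutoff.contDiff, planeCutoff.hasCompactSupport, subset_univ _⟩

section DilatedCutoff

variable {r : ℝ} {x : ℝ × ℝ}

theorem isTestOn_dilatedCutoff (hr : 0 < r) : IsTestOn univ (dilatedCutoff r) :=
  ⟨planeCutoff.contDiff.comp (by fun_prop), planeCutoff.hasCompactSupport.comp_smul hr.ne',
    subset_univ _⟩

theorem norm_dilatedCutoff_le (r : ℝ) (x : ℝ × ℝ) : ‖dilatedCutoff r x‖ ≤ 1 :=
  (Real.norm_of_nonneg planeCutoff.nonneg).trans_le planeCutoff.le_one

theorem rotGrad_dilatedCutoff (r : ℝ) (x : ℝ × ℝ) :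
    rotGrad (dilatedCutoff r) x = r • rotGrad planeCutoff (r • x) := by
  have h : dilatedCutoff r = fun y => planeCutoff (r • y) := rfl
  rw [rotGrad, h, fderiv_comp_smul]
  simp [rotGrad]

theorem eventuallyEq_dilatedCutoff (h : ‖r • x‖ < 1) : dilatedCutoff r =ᶠ[𝓝 x] fun _ => 1 := by
  filter_upwards [(isOpen_lt (f := fun y => ‖r • y‖) (by fun_prop) continuous_const).mem_nhds h]
    with y hy
  exact planeCutoff.one_of_mem_closedBall (mem_closedBall_zero_iff.2 (le_of_lt hy))

theorem rotGrad_dilatedCutoff_eq_zero (h : ‖r • x‖ < 1) : rotGrad (dilatedCutoff r) x = 0 := by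
  simp [rotGrad, (eventuallyEq_dilatedCutoff h).fderiv_eq]

/-- Both sides are invariant under dilations. -/
theorem exists_norm_rotGrad_dilatedCutoff_mul_le :
    ∃ C, ∀ r x, ‖rotGrad (dilatedCutoff r) x‖ * ‖x‖ ≤ C := by
  have hcont : Continuous fun y => ‖rotGrad planeCutoff y‖ * ‖y‖ :=
    (continuous_rotGrad isTestOn_planeCutoff).norm.mul continuous_norm
  have hsupp : HasCompactSupport fun y => ‖rotGrad planeCutoff y‖ * ‖y‖ :=
    HasCompactSupport.intro planeCutoff.hasCompactSupport.isCompact fun y hy => by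
      rw [rotGrad_eq_zero hy, norm_zero, zero_mul]
  obtain ⟨C, hC⟩ := hsupp.exists_bound_of_continuous hcont
  refine ⟨C, fun r x => ?_⟩
  calc ‖rotGrad (dilatedCutoff r) x‖ * ‖x‖
      = ‖rotGrad planeCutoff (r • x)‖ * ‖r • x‖ := by
        rw [rotGrad_dilatedCutoff, norm_smul, norm_smul]
        ring
    _ ≤ C := (Real.le_norm_self _).trans (hC _)

end DilatedCutoff

section Decay

variable (m : ℕ) (β : ℂ)

theorem norm_toComplex_le (x : ℝ × ℝ) : ‖toComplex x‖ ≤ 2 * ‖x‖ := by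
  have h₁ : |x.1| ≤ ‖x‖ := norm_fst_le x
  have h₂ : |x.2| ≤ ‖x‖ := norm_snd_le x
  have h := Complex.norm_le_abs_re_add_abs_im (toComplex x)
  simp only [toComplex] at h ⊢
  linarith

/-- `F` decays like `|z|^{-1/2}`, hence `F / |z|` like the gradient majorant. -/
theorem norm_crackFun_div_le {x : ℝ × ℝ} (hx : 1 ≤ ‖x‖) :
    ‖crackFun m (toComplex x)‖ / ‖x‖ ≤ 4 * gradMajorant m x := by
  set z := toComplex x
  set s := ‖z‖ + ‖z - 1‖
  have hxz : ‖x‖ ≤ ‖z‖ := norm_le_norm_toComplex x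
  have hzx : ‖z‖ ≤ 2 * ‖x‖ := norm_toComplex_le x
  have hz_pos : 0 < ‖z‖ := by linarith
  have hs_pos : 0 < s := by positivity
  have hsz : s ≤ 3 * ‖z‖ := by
    have h := norm_sub_le z 1
    rw [norm_one] at h
    linarith
  have hsz_sq : s * ‖z‖ ≤ ‖x‖ ^ 2 * 16 := by nlinarith
  have hpole : ‖z‖⁻¹ / s ^ 2 ≤ poleBound z := by
    unfold poleBound
    gcongr
    exact le_add_of_nonneg_right (by positivity)
  have hF : ‖crackFun m z‖ ^ 2 ≤ oddPolyBound m ^ 2 / s :=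
    (le_div_iff₀ hs_pos).2 (norm_crackFun_sq_mul_le m z)
  have hsq : (‖crackFun m z‖ / ‖x‖) ^ 2 ≤ (4 * gradMajorant m x) ^ 2 :=
    calc (‖crackFun m z‖ / ‖x‖) ^ 2 ≤ oddPolyBound m ^ 2 / s / ‖x‖ ^ 2 := by
          rw [div_pow]
          gcongr
      _ ≤ 16 * (oddPolyBound m ^ 2 * (‖z‖⁻¹ / s ^ 2)) := by
          field_simp
          rw [mul_assoc, mul_assoc]
          exact mul_le_mul_of_nonneg_left hsz_sq (sq_nonneg _)
      _ ≤ 16 * (oddPolyBound m ^ 2 * poleBound z) := by gcongr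
      _ = (4 * gradMajorant m x) ^ 2 := by
          rw [gradMajorant, mul_pow, mul_pow, Real.sq_sqrt (poleBound_nonneg _)]
          ring
  exact (sq_le_sq₀ (by positivity) (mul_nonneg zero_le_four (gradMajorant_nonneg m x))).1 hsq

theorem exists_norm_rotGradCut_dilatedCutoff_le :
    ∃ C, ∀ r ∈ Ioc (0 : ℝ) 1, ∀ x,
      ‖rotGradCut m β (dilatedCutoff r) 0 x‖ ≤ C * gradMajorant m x := by
  obtain ⟨C, hC⟩ := exists_norm_rotGrad_dilatedCutoff_mul_le
  have hC₀ : 0 ≤ C := by simpa using hC 1 0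
  refine ⟨‖β‖ * (4 * C + 1), fun r hr x => ?_⟩
  have hgm := gradMajorant_nonneg m x
  have hcut : ‖conjugate m β x • rotGrad (dilatedCutoff r) x‖
      ≤ ‖β‖ * (4 * C) * gradMajorant m x := by
    rcases lt_or_ge ‖x‖ 1 with hx | hx
    · have hrx : ‖r • x‖ < 1 := by
        rw [norm_smul, Real.norm_of_nonneg hr.1.le]
        exact mul_lt_one_of_nonneg_of_lt_one_right hr.2 (norm_nonneg x) hx
      rw [rotGrad_dilatedCutoff_eq_zero hrx, smul_zero, norm_zero]
      positivity
    · have hx₀ : ‖x‖ ≠ 0 := by positivity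
      calc ‖conjugate m β x • rotGrad (dilatedCutoff r) x‖
          ≤ ‖β‖ * ‖crackFun m (toComplex x)‖ * ‖rotGrad (dilatedCutoff r) x‖ := by
            rw [norm_smul]
            gcongr
            exact norm_conjugate_le m β x
        _ = ‖β‖ * (‖crackFun m (toComplex x)‖ / ‖x‖)
            * (‖rotGrad (dilatedCutoff r) x‖ * ‖x‖) := by
            field_simp
        _ ≤ ‖β‖ * (4 * gradMajorant m x) * C := by
            gcongr
            exacts [norm_crackFun_div_le m hx, hC r x]
        _ = _ := by ring
  have hgrad : ‖dilatedCutoff r x • potentialGrad m β x‖ ≤ ‖β‖ * gradMajorant m x := by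
    rw [norm_smul]
    exact (mul_le_of_le_one_left (norm_nonneg _) (norm_dilatedCutoff_le r x)).trans
      (norm_potentialGrad_le m β x)
  have hx_add : x + (0, (0 : ℝ)) = x := add_zero x
  rw [rotGradCut, hx_add]
  refine (norm_add_le_of_le hcut hgrad).trans_eq ?_
  ring

end Decay

theorem GreenOn.tendsto_integral_dilatedCutoff {w : ℝ × ℝ → ℝ} {g : ℝ × ℝ → ℝ × ℝ} {p : ℝ → ℝ}
    (h : GreenOn upper (0, -1) w g p) (hg : MemLp g 2 (volume.restrict upper)) (m : ℕ) (β : ℂ) :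
    Tendsto (fun r => -∫ t, p t * (rotGradCut m β (dilatedCutoff r) 0 (t, 0)).2) (𝓝[>] 0)
      (𝓝 (∫ x in upper, dot (g x) (potentialGrad m β x))) := by
  obtain ⟨C, hC⟩ := exists_norm_rotGradCut_dilatedCutoff_le m β
  have hlim : Tendsto (fun r => ∫ x in upper, dot (g x) (rotGradCut m β (dilatedCutoff r) 0 x))
      (𝓝[>] 0) (𝓝 (∫ x in upper, dot (g x) (potentialGrad m β x))) := by
    refine tendsto_integral_filter_of_dominated_convergence
      (fun x => 2 * C * (‖g x‖ * gradMajorant m x)) ?_ ?_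
      ((hg.norm.integrable_mul ((memLp_gradMajorant m).restrict upper)).const_mul _)
      (Eventually.of_forall fun x => ?_)
    · filter_upwards [self_mem_nhdsWithin] with r hr
      have hmeas : AEStronglyMeasurable (rotGradCut m β (dilatedCutoff r) 0)
          (volume.restrict upper) :=
        (measurable_rotGradCut (isTestOn_dilatedCutoff hr)).aestronglyMeasurable
      exact (hg.aestronglyMeasurable.fst.mul hmeas.fst).add
        (hg.aestronglyMeasurable.snd.mul hmeas.snd)
    · filter_upwards [Ioc_mem_nhdsGT zero_lt_one] with r hr
      refine Eventually.of_forall fun x => (abs_dot_le _ _).trans ?_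
      calc 2 * (‖g x‖ * ‖rotGradCut m β (dilatedCutoff r) 0 x‖)
          ≤ 2 * (‖g x‖ * (C * gradMajorant m x)) := by gcongr; exact hC r hr x
        _ = _ := by ring
    · have hsmall : Tendsto (fun r : ℝ => ‖r • x‖) (𝓝[>] 0) (𝓝 0) :=
        (Continuous.tendsto' (by fun_prop) 0 0 (by simp)).mono_left nhdsWithin_le_nhds
      refine tendsto_const_nhds.congr' ?_
      filter_upwards [hsmall.eventually_lt_const zero_lt_one] with r hr
      have hx_add : x + (0, (0 : ℝ)) = x := add_zero x
      rw [rotGradCut, rotGrad_dilatedCutoff_eq_zero hr, (eventuallyEq_dilatedCutoff hr).eq_of_nhds,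
        hx_add, smul_zero, zero_add, one_smul]
  refine hlim.congr' ?_
  filter_upwards [self_mem_nhdsWithin] with r hr
  exact h.integral_dot_rotGradCut hg (isTestOn_dilatedCutoff hr)

/-! ### Orthogonality -/

section Axis

variable (m : ℕ) (β : ℂ)

theorem reflect_potentialGrad_reflect {x : ℝ × ℝ} (hx : x ∈ crackᶜ) :
    reflect (potentialGrad m β (reflect x)) = potentialGrad m (conj β) x := by
  have h : conj β * crackFunDeriv m (toComplex x)
      = conj (β * conj (crackFunDeriv m (toComplex x))) := by simp
  rw [potentialGrad, toComplex_reflect,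
    crackFunDeriv_conj m (toComplex_sub_one_mem_slitPlane hx), potentialGrad, h, reflect_apply,
    Complex.conj_re, Complex.conj_im]

theorem integral_dot_potentialGrad_lower (g : ℝ × ℝ → ℝ × ℝ) :
    ∫ x in lower, dot (g x) (potentialGrad m β x)
      = ∫ x in upper, dot (reflect (g (reflect x))) (potentialGrad m (conj β) x) := by
  rw [← setIntegral_comp_equiv measurePreserving_reflect, reflect_preimage_lower]
  refine setIntegral_congr_fun isOpen_upper.measurableSet fun x hx => ?_
  simp only [← reflect_potentialGrad_reflect m β (upper_subset_compl_crack hx), dot_reflect_left,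
    reflect_reflect]

theorem rotGradCut_axis_snd (χ : ℝ × ℝ → ℝ) (t : ℝ) :
    (rotGradCut m β χ 0 (t, 0)).2 = (β * crackFun m t).im * (rotGrad χ (t, 0)).2
      - χ (t, 0) * (β * crackFunDeriv m t).im := by
  have ht : ((t, 0) : ℝ × ℝ) + (0, 0) = (t, 0) := add_zero _
  rw [rotGradCut, ht, conjugate_eq, potentialGrad, toComplex_axis]
  simp only [Prod.snd_add, Prod.smul_snd, smul_eq_mul]
  ring

/-- On the crack the two sides add up through `Re F'`, off the crack they cancel because `F` and
`F'` are real there. -/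
theorem neg_trace_mul_rotGradCut_add {p q : ℝ → ℝ} {r t : ℝ} (hr : r ∈ Ioc 0 1) (ht₀ : t ≠ 0)
    (ht₁ : t ≠ 1) (hcrack : t ≤ 1 → p t + q t = 0) (hoff : 1 < t → p t = q t) :
    -(p t * (rotGradCut m β (dilatedCutoff r) 0 (t, 0)).2
      + q t * (rotGradCut m (conj β) (dilatedCutoff r) 0 (t, 0)).2)
      = (Icc 0 1).indicator (fun t => ((2 * m + 1 : ℕ) : ℝ) * β.im *
        (t ^ (((2 * m + 1 : ℕ) : ℝ) / 2 - 1) * p t)) t := by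
  simp only [rotGradCut_axis_snd, Complex.mul_im, Complex.conj_re, Complex.conj_im]
  rcases lt_or_gt_of_ne ht₁ with ht₁ | ht₁
  · have hq : q t = -p t := by linarith [hcrack ht₁.le]
    rcases lt_or_gt_of_ne ht₀ with ht₀ | ht₀
    · rw [indicator_of_notMem fun h => absurd h.1 ht₀.not_ge, crackFun_re_of_nonpos m ht₀.le,
        crackFunDeriv_re_of_nonpos m ht₀.le, hq]
      ring
    · have hrt : ‖r • ((t, 0) : ℝ × ℝ)‖ < 1 := by
        have ht : ‖((t, 0) : ℝ × ℝ)‖ = t := by simp [Prod.norm_def, abs_of_pos ht₀, ht₀.le]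
        rw [norm_smul, ht, Real.norm_of_nonneg hr.1.le]
        exact mul_lt_one_of_nonneg_of_lt_one_right hr.2 ht₀.le ht₁
      rw [indicator_of_mem (mem_Icc.2 ⟨ht₀.le, ht₁.le⟩), rotGrad_dilatedCutoff_eq_zero hrt,
        (eventuallyEq_dilatedCutoff hrt).eq_of_nhds, crackFunDeriv_re_of_mem m ⟨ht₀, ht₁⟩, hq,
        Prod.snd_zero]
      ring
  · rw [indicator_of_notMem fun h => absurd h.2 ht₁.not_ge, crackFun_im_of_ge m ht₁.le,
      crackFunDeriv_im_of_ge m ht₁.le, hoff ht₁]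
    ring

end Axis

/-- The properties of an element `w` of `XTilde` with weak gradient `g` and traces `p` and `q` on
which the variational argument rests; they are stable under differences. -/
structure IsAdmissible (w : ℝ × ℝ → ℝ) (g : ℝ × ℝ → ℝ × ℝ) (p q : ℝ → ℝ) : Prop where
  memLp : MemLp g 2
  above : GreenOn upper (0, -1) w g p
  below : GreenOn lower (0, 1) w g q
  left : ∀ᵐ t : ℝ, t ≤ 0 → p t + q t = 0
  right : ∀ᵐ t : ℝ, 1 < t → p t = q t

section Admissible

variable {w w' : ℝ × ℝ → ℝ} {g g' : ℝ × ℝ → ℝ × ℝ} {p p' q q' : ℝ → ℝ}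

theorem isAdmissible_of_mem_XTilde (hw : w ∈ XTilde) (hg : HasWeakGrad crackᶜ w g)
    (hp : IsUpperTrace w p) (hq : IsLowerTrace w q) : IsAdmissible w g p q := by
  obtain ⟨-, -, ⟨g', hg', hmem⟩, p', q', hp', hq', hsum⟩ := hw
  have hgrad := hg'.ae_eq isClosed_crack.isOpen_compl hg
  rw [restrict_compl_crack] at hmem hgrad
  have hup {p} (hp : IsUpperTrace w p) : GreenOn upper (0, -1) w g p :=
    IsTrace.greenOn isOpen_upper axis_notMem_upper upper_subset_compl_crack hp hg
  have hlow {q} (hq : IsLowerTrace w q) : GreenOn lower (0, 1) w g q :=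
    IsTrace.greenOn isOpen_lower axis_notMem_lower lower_subset_compl_crack hq hg
  refine ⟨hmem.ae_eq hgrad, hup hp, hlow hq, ?_, traces_ae_eq_off_crack hg (hup hp) (hlow hq)⟩
  rw [ae_restrict_iff' measurableSet_Iic] at hsum
  filter_upwards [hsum, (hup hp).trace_ae_eq (by simp [dot]) (hup hp'),
    (hlow hq).trace_ae_eq (by simp [dot]) (hlow hq')] with t ht hpt hqt ht₀
  rw [hpt, hqt, ht ht₀]

theorem IsAdmissible.sub (h : IsAdmissible w g p q) (h' : IsAdmissible w' g' p' q') :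
    IsAdmissible (w - w') (g - g') (p - p') (q - q') where
  memLp := h.memLp.sub h'.memLp
  above := h.above.sub h'.above
  below := h.below.sub h'.below
  left := by
    filter_upwards [h.left, h'.left] with t ht ht' ht₀
    simp only [Pi.sub_apply]
    linarith [ht ht₀, ht' ht₀]
  right := by
    filter_upwards [h.right, h'.right] with t ht ht' ht₁
    simp only [Pi.sub_apply, ht ht₁, ht' ht₁]

theorem IsAdmissible.integral_dot_potentialGrad (h : IsAdmissible w g p q)
    (h₀ : ∀ᵐ t : ℝ, t ∈ Icc 0 1 → p t + q t = 0) (m : ℕ) (β : ℂ) :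
    ∫ x, dot (g x) (potentialGrad m β x) = ((2 * m + 1 : ℕ) : ℝ) * β.im *
      ∫ t in Icc (0 : ℝ) 1, t ^ (((2 * m + 1 : ℕ) : ℝ) / 2 - 1) * p t := by
  have hbelow := h.below.comp_reflect_of_lower
  have hg := h.memLp.restrict upper
  have hg' := (memLp_comp_reflect h.memLp).restrict upper
  rw [integral_eq_upper_add_lower (integrable_dot h.memLp (memLp_potentialGrad m β)),
    integral_dot_potentialGrad_lower]
  refine tendsto_nhds_unique ((h.above.tendsto_integral_dilatedCutoff hg m β).add
    (hbelow.tendsto_integral_dilatedCutoff hg' m (conj β))) (tendsto_const_nhds.congr' ?_)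
  filter_upwards [Ioc_mem_nhdsGT zero_lt_one] with r hr
  have hχ := isTestOn_dilatedCutoff hr.1
  rw [← neg_add, ← integral_add (h.above.integrable_trace_mul_rotGradCut hg hχ)
    (hbelow.integrable_trace_mul_rotGradCut hg' hχ), ← integral_const_mul, ← integral_neg,
    ← integral_indicator measurableSet_Icc]
  refine integral_congr_ae ?_
  filter_upwards [h.left, h.right, h₀, Measure.ae_ne volume (0 : ℝ), Measure.ae_ne volume (1 : ℝ)]
    with t hleft hright hmid ht₀ ht₁
  have hcrack (ht : t ≤ 1) : p t + q t = 0 :=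
    (le_total t 0).elim hleft fun ht' => hmid ⟨ht', ht⟩
  exact (neg_trace_mul_rotGradCut_add m β hr ht₀ ht₁ hcrack hright).symm

theorem GreenOn.integrableOn_rpow_mul (h : GreenOn upper (0, -1) w g p)
    (hg : MemLp g 2 (volume.restrict upper)) (m : ℕ) :
    IntegrableOn (fun t => t ^ (((2 * m + 1 : ℕ) : ℝ) / 2 - 1) * p t) (Icc 0 1) := by
  have hint := h.integrable_trace_mul_inv_sqrt hg 0 ((continuous_pow m).mul cutoff.continuous)
    cutoff.hasCompactSupport.mul_left
  rw [integrableOn_Icc_iff_integrableOn_Ioc]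
  refine hint.integrableOn.congr_fun (fun t ht => ?_) measurableSet_Ioc
  have hpow : t ^ (((2 * m + 1 : ℕ) : ℝ) / 2 - 1) = t ^ m * (√t)⁻¹ := by
    rw [Real.rpow_sub ht.1, Real.rpow_one, ← sqrt_pow_eq_rpow ht.1.le, pow_succ, pow_mul,
      Real.sq_sqrt ht.1.le, mul_div_assoc, Real.sqrt_div_self', one_div]
  have hcut : cutoff t = 1 := cutoff_eq_one ((abs_of_pos ht.1).trans_le ht.2)
  simp only [Pi.mul_apply, sub_zero, abs_of_pos ht.1, hcut, mul_one, hpow]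
  ring

end Admissible

/-! ### The minimiser -/

section Minimiser

variable (m : ℕ) (β : ℂ)

theorem potential_axis (t : ℝ) :
    potential m β (t, 0) = β.re * (crackFun m t).re - β.im * (crackFun m t).im := by
  rw [potential, toComplex_axis, Complex.mul_re]

theorem potential_conj_reflect {x : ℝ × ℝ} (hx : x ∈ crackᶜ) :
    potential m (conj β) (reflect x) = potential m β x := by
  rw [potential, toComplex_reflect, crackFun_conj m (toComplex_sub_one_mem_slitPlane hx),
    ← map_mul, Complex.conj_re, potential]

theorem hasWeakGrad_potential : HasWeakGrad crackᶜ (potential m β) (potentialGrad m β) :=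
  hasWeakGrad_of_hasFDerivAt (fun _ => hasFDerivAt_potential m β)
    ((locallyIntegrable_potential m β).locallyIntegrableOn _)
    ((locallyIntegrable_potentialGrad m β).locallyIntegrableOn _)

theorem greenOn_potential : GreenOn upper (0, -1) (potential m β) (potentialGrad m β)
    fun t => potential m β (t, 0) :=
  greenOn_of_hasFDerivAt (fun _ hx => hasFDerivAt_potential m β (upper_subset_compl_crack hx))
    (continuousOn_potential m β)
    ((locallyIntegrable_potential m β).mono_measure Measure.restrict_le_self)
    ((locallyIntegrable_potentialGrad m β).mono_measure Measure.restrict_le_self)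

theorem isUpperTrace_potential :
    IsUpperTrace (potential m β) fun t => potential m β (t, 0) :=
  isTrace_iff_exists_greenOn.2 ⟨_, greenOn_potential m β⟩

theorem isLowerTrace_potential :
    IsLowerTrace (potential m β) fun t => potential m (conj β) (t, 0) := by
  refine (isTrace_iff_exists_greenOn.2
    ⟨_, (greenOn_potential m (conj β)).comp_reflect_of_upper⟩).congr ?_
  filter_upwards [ae_restrict_mem isOpen_lower.measurableSet] with x hx
  exact potential_conj_reflect m β (lower_subset_compl_crack hx)

theorem memLp_potential_of_isBounded {U : Set (ℝ × ℝ)} (hU : Bornology.IsBounded U) :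
    MemLp (potential m β) 2 (volume.restrict U) :=
  have : IsFiniteMeasure (volume.restrict U) := ⟨by simpa using hU.measure_lt_top⟩
  .of_bound (measurable_potential m β).aestronglyMeasurable (‖β‖ * oddPolyBound m)
    (Eventually.of_forall (norm_potential_le_const m β))

theorem isBounded_disk (r : ℝ) : Bornology.IsBounded (disk r) := by
  refine (isCompact_Icc.prod isCompact_Icc).isBounded.subset
    (t := Icc (-|r|) |r| ×ˢ Icc (-|r|) |r|) fun x hx => ?_
  have hx : x.1 ^ 2 + x.2 ^ 2 < r ^ 2 := hx
  exact ⟨abs_le.1 (sq_le_sq.1 (by nlinarith [sq_nonneg x.2])),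
    abs_le.1 (sq_le_sq.1 (by nlinarith [sq_nonneg x.1]))⟩

theorem potential_mem_XTilde : potential m β ∈ XTilde := by
  refine ⟨locallyIntegrable_potential m β, fun r _ =>
    ⟨memLp_potential_of_isBounded m β ((isBounded_disk r).subset sdiff_subset), _,
      (hasWeakGrad_potential m β).mono fun _ hx => hx.2, (memLp_potentialGrad m β).restrict _⟩,
    ⟨_, hasWeakGrad_potential m β, (memLp_potentialGrad m β).restrict _⟩, _, _,
    isUpperTrace_potential m β, isLowerTrace_potential m β, ?_⟩
  filter_upwards [ae_restrict_mem measurableSet_Iic] with t ht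
  rw [potential_axis, potential_axis, crackFun_re_of_nonpos m ht, Complex.conj_im]
  ring

theorem isAdmissible_potential : IsAdmissible (potential m β) (potentialGrad m β)
    (fun t => potential m β (t, 0)) (fun t => potential m (conj β) (t, 0)) :=
  isAdmissible_of_mem_XTilde (potential_mem_XTilde m β) (hasWeakGrad_potential m β)
    (isUpperTrace_potential m β) (isLowerTrace_potential m β)

theorem potential_axis_add {t : ℝ} (ht : t ∈ Icc 0 1) :
    potential m β (t, 0) + potential m (conj β) (t, 0)
      = 2 * t ^ (((2 * m + 1 : ℕ) : ℝ) / 2) * β.re := by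
  rw [potential_axis, potential_axis, crackFun_re_of_mem m ht, Complex.conj_re, Complex.conj_im]
  ring

end Minimiser

/-! ### The energy -/

section Energy

variable (m : ℕ)

/-- Half the Dirichlet integral of the holomorphic function `F`, the constant `A` in
`G ζ = -A cos 2ζ`. -/
noncomputable def dirichlet : ℝ := (1 / 2 : ℝ) * ∫ x, ‖crackFunDeriv m (toComplex x)‖ ^ 2

theorem dot_potentialGrad_self (β : ℂ) (x : ℝ × ℝ) :
    dot (potentialGrad m β x) (potentialGrad m β x)
      = ‖β‖ ^ 2 * ‖crackFunDeriv m (toComplex x)‖ ^ 2 := by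
  rw [← mul_pow, ← norm_mul, ← Complex.normSq_eq_norm_sq, Complex.normSq_apply, dot, potentialGrad]
  ring

theorem integral_dot_potentialGrad_self (β : ℂ) :
    ∫ x, dot (potentialGrad m β x) (potentialGrad m β x) = ‖β‖ ^ 2 * (2 * dirichlet m) := by
  simp only [dot_potentialGrad_self, integral_const_mul, dirichlet]
  ring

theorem eventually_crackFunDeriv_ne_zero :
    ∀ᶠ x in 𝓝 ((2, 0) : ℝ × ℝ), crackFunDeriv m (toComplex x) ≠ 0 := by
  have hmem : ((2, 0) : ℝ × ℝ) ∈ crackᶜ := fun h => absurd h.1 (by norm_num)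
  have hne : fderiv ℝ (potential m 1) (2, 0) ≠ 0 := fun h => by
    have hdot : dot (potentialGrad m 1 (2, 0)) (potentialGrad m 1 (2, 0)) = 0 := by
      rw [← dotCLM_apply, ← (hasFDerivAt_potential m 1 hmem).fderiv, h, zero_apply]
    rw [dot_potentialGrad_self, norm_one, one_pow, one_mul, sq_eq_zero_iff, norm_eq_zero] at hdot
    exact crackFunDeriv_ofReal_ne_zero m one_lt_two hdot
  have hcont : ContinuousAt (fderiv ℝ (potential m 1)) (2, 0) :=
    ((contDiffAt_potential m 1 hmem).fderiv_right (m := 0) (by simp)).continuousAt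
  filter_upwards [hcont.eventually_ne hne, isClosed_crack.isOpen_compl.mem_nhds hmem]
    with x hx hxc h
  rw [(hasFDerivAt_potential m 1 hxc).fderiv] at hx
  refine hx (ContinuousLinearMap.ext fun a => ?_)
  simp [dotCLM_apply, potentialGrad, dot, h]

theorem dirichlet_pos : 0 < dirichlet m := by
  have hint : Integrable fun x => ‖crackFunDeriv m (toComplex x)‖ ^ 2 := by
    simpa only [dot_potentialGrad_self, norm_one, one_pow, one_mul] using
      integrable_dot (memLp_potentialGrad m 1) (memLp_potentialGrad m 1)
  refine mul_pos one_half_pos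
    ((integral_pos_iff_support_of_nonneg (fun x => by positivity) hint).2 ?_)
  refine Measure.measure_pos_of_mem_nhds volume (x := (2, 0)) ?_
  filter_upwards [eventually_crackFunDeriv_ne_zero m] with x hx
  exact pow_ne_zero 2 (norm_ne_zero_iff.2 hx)

theorem integral_rpow_mul_crackFun_im : ((2 * m + 1 : ℕ) : ℝ) *
    ∫ t in Icc (0 : ℝ) 1, t ^ (((2 * m + 1 : ℕ) : ℝ) / 2 - 1) * (crackFun m t).im
      = -(2 * dirichlet m) := by
  have horth := (isAdmissible_potential m (-I)).integral_dot_potentialGrad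
    (Eventually.of_forall fun t ht => (potential_axis_add m (-I) ht).trans (by simp)) m (-I)
  rw [integral_dot_potentialGrad_self] at horth
  simp only [potential_axis, norm_neg, Complex.norm_I, Complex.neg_re, Complex.neg_im, Complex.I_re,
    Complex.I_im] at horth
  simp only [neg_zero, zero_mul, neg_mul, one_mul, sub_neg_eq_add, zero_add] at horth
  linarith

theorem integral_rpow_mul_crackFun_re : ((2 * m + 1 : ℕ) : ℝ) *
    ∫ t in Icc (0 : ℝ) 1, t ^ (((2 * m + 1 : ℕ) : ℝ) / 2 - 1) * (crackFun m t).re = 1 := by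
  set k : ℝ := ((2 * m + 1 : ℕ) : ℝ) with hk
  have hk₀ : 0 < k := Nat.cast_pos.2 (Nat.succ_pos _)
  have hint : ∫ t in Icc (0 : ℝ) 1, t ^ (k / 2 - 1) * (crackFun m t).re
      = ∫ t in (0 : ℝ)..1, t ^ (k - 1) := by
    rw [intervalIntegral.integral_of_le zero_le_one, integral_Icc_eq_integral_Ioc]
    refine setIntegral_congr_fun measurableSet_Ioc fun t ht => ?_
    simp only [crackFun_re_of_mem m (Ioc_subset_Icc_self ht), ← hk, ← Real.rpow_add ht.1]
    ring_nf
  rw [hint, integral_rpow (Or.inl (by linarith)), sub_add_cancel, Real.one_rpow,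
    Real.zero_rpow hk₀.ne', sub_zero, mul_one_div_cancel hk₀.ne']

theorem integral_rpow_mul_potential (β : ℂ) : ((2 * m + 1 : ℕ) : ℝ) *
    ∫ t in Icc (0 : ℝ) 1, t ^ (((2 * m + 1 : ℕ) : ℝ) / 2 - 1) * potential m β (t, 0)
      = β.re + β.im * (2 * dirichlet m) := by
  have hint (γ : ℂ) := (greenOn_potential m γ).integrableOn_rpow_mul
    ((memLp_potentialGrad m γ).restrict upper) m
  have hre : IntegrableOn (fun t : ℝ =>
      t ^ (((2 * m + 1 : ℕ) : ℝ) / 2 - 1) * (crackFun m t).re) (Icc 0 1) := by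
    simpa [potential_axis] using hint 1
  have him : IntegrableOn (fun t : ℝ =>
      t ^ (((2 * m + 1 : ℕ) : ℝ) / 2 - 1) * (crackFun m t).im) (Icc 0 1) := by
    simpa [potential_axis] using hint (-I)
  simp only [potential_axis, mul_sub, mul_left_comm _ β.re, mul_left_comm _ β.im]
  rw [integral_sub (hre.const_mul _) (him.const_mul _), integral_const_mul, integral_const_mul,
    mul_sub, mul_left_comm, mul_left_comm _ β.im, integral_rpow_mul_crackFun_re,
    integral_rpow_mul_crackFun_im]
  ring

theorem integral_dot_self_eq {g g' : ℝ × ℝ → ℝ × ℝ} (hg : MemLp g 2) (hg' : MemLp g' 2) :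
    ∫ x, dot (g x) (g x) = (∫ x, dot (g' x) (g' x)) + 2 * (∫ x, dot ((g - g') x) (g' x))
      + ∫ x, dot ((g - g') x) ((g - g') x) := by
  have hd := hg.sub hg'
  have hi := integrable_dot hg' hg'
  have hi' := (integrable_dot hd hg').const_mul 2
  rw [← integral_const_mul, ← integral_add hi hi', ← integral_add (hi.fun_add hi')
    (integrable_dot hd hd)]
  congr 1 with x
  simp only [dot, Pi.sub_apply, Prod.fst_sub, Prod.snd_sub]
  ring

variable {m} {w : ℝ × ℝ → ℝ} {g : ℝ × ℝ → ℝ × ℝ} {p q : ℝ → ℝ}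

theorem IsAdmissible.energy_eq {β : ℂ} (h : IsAdmissible w g p q)
    (hpq : ∀ᵐ t : ℝ, t ∈ Icc 0 1 → p t + q t = 2 * t ^ (((2 * m + 1 : ℕ) : ℝ) / 2) * β.re) :
    (1 / 2 : ℝ) * (∫ x, dot (g x) (g x)) - ((2 * m + 1 : ℕ) : ℝ) * β.im *
        (∫ t in Icc (0 : ℝ) 1, t ^ (((2 * m + 1 : ℕ) : ℝ) / 2 - 1) * p t)
      = dirichlet m * (β.re ^ 2 - β.im ^ 2) - β.re * β.im
        + (1 / 2 : ℝ) * ∫ x, dot ((g - potentialGrad m β) x) ((g - potentialGrad m β) x) := by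
  have hu := isAdmissible_potential m β
  have horth := (h.sub hu).integral_dot_potentialGrad (by
    filter_upwards [hpq] with t ht hmem
    simp only [Pi.sub_apply]
    linarith [ht hmem, potential_axis_add m β hmem]) m β
  simp only [Pi.sub_apply p, mul_sub] at horth
  rw [integral_sub (h.above.integrableOn_rpow_mul (h.memLp.restrict _) m)
    (hu.above.integrableOn_rpow_mul (hu.memLp.restrict _) m)] at horth
  have hboundary := integral_rpow_mul_potential m β
  have hnorm : ‖β‖ ^ 2 = β.re ^ 2 + β.im ^ 2 := by
    rw [← Complex.normSq_eq_norm_sq, Complex.normSq_apply]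
    ring
  rw [integral_dot_self_eq h.memLp hu.memLp, integral_dot_potentialGrad_self, hnorm, horth]
  linear_combination -β.im * hboundary

end Energy

section Minimum

variable (m : ℕ) (ζ : ℝ)

theorem isLeast_energyValues :
    IsLeast (energyValues (2 * m + 1) ζ) (-(dirichlet m * Real.cos (2 * ζ))) := by
  obtain ⟨β, hre, him⟩ : ∃ β : ℂ, β.re = Real.sin ζ ∧ β.im = -Real.cos ζ :=
    ⟨⟨Real.sin ζ, -Real.cos ζ⟩, rfl, rfl⟩
  constructor
  · have hpq (t : ℝ) (ht : t ∈ Icc 0 1) := potential_axis_add m β ht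
    have henergy := (isAdmissible_potential m β).energy_eq (Eventually.of_forall hpq)
    have hzero : ∫ x, dot ((potentialGrad m β - potentialGrad m β) x)
        ((potentialGrad m β - potentialGrad m β) x) = 0 := by simp [dot]
    rw [hzero, hre, him] at henergy
    simp only [hre] at hpq
    refine ⟨potential m β, potential_mem_XTilde m β, potentialGrad m β, _, _,
      hasWeakGrad_potential m β, isUpperTrace_potential m β, isLowerTrace_potential m β,
      ae_restrict_of_forall_mem measurableSet_Icc hpq, ?_⟩
    rw [restrict_compl_crack, Real.cos_two_mul']
    linear_combination -henergy
  · rintro E ⟨v, hv, g, p, q, hg, hp, hq, hpq, rfl⟩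
    rw [ae_restrict_iff' measurableSet_Icc, ← hre] at hpq
    have henergy := (isAdmissible_of_mem_XTilde hv hg hp hq).energy_eq hpq
    have hnonneg : 0 ≤ ∫ x, dot ((g - potentialGrad m β) x) ((g - potentialGrad m β) x) :=
      integral_nonneg fun _ => add_nonneg (mul_self_nonneg _) (mul_self_nonneg _)
    rw [hre, him] at henergy
    rw [restrict_compl_crack, Real.cos_two_mul']
    linarith

theorem G_eq : G (2 * m + 1) ζ = -(dirichlet m * Real.cos (2 * ζ)) :=
  (isLeast_energyValues m ζ).csInf_eq

theorem strictMonoOn_G : StrictMonoOn (G (2 * m + 1)) (Icc 0 (Real.pi / 2)) := by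
  intro a ha b hb hab
  rw [G_eq, G_eq, neg_lt_neg_iff]
  refine mul_lt_mul_of_pos_left ?_ (dirichlet_pos m)
  exact Real.strictAntiOn_cos ⟨by linarith [ha.1], by linarith [ha.2]⟩
    ⟨by linarith [hb.1], by linarith [hb.2]⟩ (by linarith)

end Minimum

end SlitPlane

theorem lemma4p1 (k : ℕ) (hk : Odd k) :
    (∀ ζ : ℝ, IsLeast (SlitPlane.energyValues k ζ) (SlitPlane.G k ζ)) ∧
    Continuous (SlitPlane.G k) ∧
    (SlitPlane.G k 0 < 0 ∧ 0 < SlitPlane.G k (Real.pi / 2)) ∧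
    (∀ ζ : ℝ, SlitPlane.G k (ζ + Real.pi) = SlitPlane.G k ζ) ∧
    (∀ ζ : ℝ, SlitPlane.G k (Real.pi - ζ) = SlitPlane.G k ζ) ∧
    StrictMonoOn (SlitPlane.G k) (Set.Ioo (Real.pi / 4) (Real.pi / 2)) ∧
    (∀ I : Set ℝ, I.OrdConnected → I ⊆ Set.Ioo 0 (Real.pi / 2) →
      (∀ ζ ∈ I, 0 < SlitPlane.G k ζ) → StrictMonoOn (SlitPlane.G k) I) := by
  obtain ⟨m, rfl⟩ := hk
  have hA := SlitPlane.dirichlet_pos m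
  have hG := SlitPlane.G_eq m
  have hmono := SlitPlane.strictMonoOn_G m
  refine ⟨fun ζ => ?_, ?_, ⟨?_, ?_⟩, fun ζ => ?_, fun ζ => ?_, ?_, fun I _ hI _ => ?_⟩
  · rw [hG]
    exact SlitPlane.isLeast_energyValues m ζ
  · rw [show SlitPlane.G (2 * m + 1) = _ from funext hG]
    fun_prop
  · rw [hG, mul_zero, Real.cos_zero]
    linarith
  · rw [hG, mul_div_cancel₀ _ two_ne_zero, Real.cos_pi]
    linarith
  · rw [hG, hG, mul_add, Real.cos_add_two_pi]
  · rw [hG, hG, mul_sub, Real.cos_two_pi_sub]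
  · exact hmono.mono fun ζ hζ => ⟨by linarith [hζ.1, Real.pi_pos], hζ.2.le⟩
  · exact hmono.mono fun ζ hζ => ⟨(hI hζ).1.le, (hI hζ).2.le⟩
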